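/- **Setting.** Everything is $C^\infty$. Let $S$ be a compact connected 3-manifold with nonempty boundary $\Sigma=\partial S$, $M_0=\mathbb R\times S$, $S_0=\{0\}\times S$, $\mathcal C_0=\mathbb R\times\Sigma$, $\Upsilon=S_0\cup\mathcal C_0$. Fix: a time function $t_0$ on $M_0$, strictly increasing along the factor $\mathbb R$ and with zero set $S_0$ (with level sets $S_\tau$, and $\Sigma_\tau=S_\tau\cap\mathcal C_0$); a Riemannian metric $g_R$ on $M_0$ for which $S_0\perp\mathcal C_0$ along $\Sigma_0=S_0\cap\mathcal C_0$; a vector field $\Theta_{\mathcal C}$ on $\mathcal C_0$; reals $a,b,c$. Let $\mathrm{Diff}'(\Sigma)$ be the group of diffeomorphisms of $\Sigma$ isotopic to the identity and fixing chosen base points (three on each component $\cong S^2$, one on each component $\cong T^2$, none on the others), and fix a slice of space-form metrics (curvature $1$, $0$ or $-1$ on each component) for the action of $\mathrm{Diff}'(\Sigma)$ and of conformal changes on metrics of $\Sigma$. For a Riemannian metric $\gamma$ on $S$, let $n_\gamma$ be the field of inward unit normals to the equidistant foliation from $\Sigma$, on a collar of $\Sigma$, and let $\Phi_{\gamma_\Sigma}\in\mathrm{Diff}'(\Sigma)$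 be the diffeomorphism such that $(\Phi_{\gamma_\Sigma}^{-1})^*(\gamma|_\Sigma)$ is pointwise conformal to a metric of the slice. Let $E_\gamma$ be the map from the collar to $S_0$ with $E_\gamma=\Phi_{\gamma_\Sigma}$ on $\Sigma$ and $(E_\gamma)_*n_\gamma=n_{g_R}$. *Associated wave map.* Let $(M,g)$ be a time-oriented Lorentz 4-manifold with timelike boundary $M_{\mathcal C}$, in which $S$ is embedded as a spacelike hypersurface with $\partial S\subset M_{\mathcal C}$ and induced metric $g_S$. The wave map $\varphi_g:\mathcal U\to M_0$ associated to $g$ on an open neighbourhood $\mathcal U$ of $M_{\mathcal C}$ is the solution of $$\Box_g\varphi_g+\Gamma_{g_R}(\varphi_g)\,g(\nabla\varphi_g,\nabla\varphi_g)=0\ \text{ on }\mathcal U,\qquad \varphi_g=E_{g_S},\ (\varphi_g)_*N_g=T_{g_R}\ \text{ on } S\cap\mathcal U,$$ $$\varphi_g(M_{\mathcal C})\subset\mathcal C_0,\qquad \big((\varphi_g)_*(T^c_g+\nu_g)\big)^T=\Theta_{\mathcal C}\ \text{ on }M_{\mathcal C}.$$ Here $N_g$ is, on $\Sigma$, the future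 unit normal of $\Sigma$ in $M_{\mathcal C}$, and is extended by $g$-parallel transport along the flow of $n_{g_S}$; $T_{g_R}$ is the future $g_R$-unit normal of $S_0$; $T^c_g$ is the future unit normal, within $M_{\mathcal C}$, of the level sets of $t_0\circ\varphi_g$; $\nu_g$ is the outward unit normal of $M_{\mathcal C}$; and ${}^T$ is the $g_R$-orthogonal projection to $T\mathcal C_0$. *Vacuum development.* Let $\mathbb I=(\gamma,\kappa)$ be a Riemannian metric and a symmetric 2-tensor on $S$, and let $\mathbb B=([\sigma],H)$ be a smooth field of conformal classes of metrics on the leaves $\Sigma_\tau$ together with a smooth function on $\mathcal C_0$. A *vacuum development* of $(\Upsilon,\mathbb I,\mathbb B)$ is a manifold $M\cong(-1,1)\times S$ with boundary $M_{\mathcal C}$ and with a time-oriented Lorentz metric $g$ such that: 1. $g$ is Ricci-flat; 2. $(M,g)$ is globally hyperbolic with timelike boundary; 3. there are a connected, relatively open $\Upsilon'\subset\Upsilon$ containing $S_0$ and an embedding $\iota:\Upsilon'\to M$ (smooth on $S_0$ and on $\mathcal C_0\cap\Upsilon'$) such that $\iota(S_0)$ is a Cauchy hypersurface and $\iota(\mathcal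 C_0\cap\Upsilon')=M_{\mathcal C}$; 4. the metric and second fundamental form that $g$ induces on $S\cong\iota(S_0)$ are $\gamma$ and $\kappa$; 5. on some open neighbourhood of $M_{\mathcal C}$ the associated wave map $\varphi_g$ is a diffeomorphism onto its image, and $h=(\varphi_g^{-1})^*g$ satisfies, on $\mathcal C_0\cap\varphi_g(M_{\mathcal C})$, that $h|_{\Sigma_\tau}$ is pointwise conformal to $\sigma$ and $$a\,\mathrm{tr}_{\Sigma_\tau}K_{h|S_\tau}+b\,\mathrm{tr}_{\mathcal C_0}K_{h|\mathcal C_0}+c\,\mathrm{tr}_{\Sigma_\tau}K_{h|\mathcal C_0}=H,$$ where $K$ denotes second fundamental forms and traces are taken with respect to $h$; 6. $t_0\circ\varphi_g$ is a time function near $M_{\mathcal C}$, and $\varphi_g(M_{\mathcal C})=\{q\in\mathcal C_0:\tau_1<t_0(q)<\tau_2\}$ for some $-\infty\le\tau_1<0<\tau_2\le\infty$. *Extension.* Let $(M,g)$ and $(M',g')$ be vacuum developments of the same $(\Upsilon,\mathbb I,\mathbb B)$, with embeddings $\iota$, $\iota'$. Then $(M',g')$ is an *extension* of $(M,g)$ if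 there is an isometric embedding $\Psi:(M,g)\to(M',g')$ with $$\Psi\circ\iota=\iota'\ \text{ on } S_0,\qquad \Psi=\varphi_{g'}^{-1}\circ\varphi_g\ \text{ on } M_{\mathcal C}.\tag{$*$}$$ **Lemma.** If $(M',g')$ is an extension of the vacuum development $(M,g)$, then there is exactly one isometric embedding $\Psi:(M,g)\to(M',g')$ satisfying $(*)$. -/

import Mathlib

open Set Filter Topology Manifold
open scoped ContDiff

noncomputable section

namespace IBVP

/-! ## Linear algebra of bilinear forms on a finite-dimensional space -/

section LinearAlgebra

variable {V : Type*} [AddCommGroup V] [Module ℝ V] [Module.Finite ℝ V]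
  {W : Type*} [AddCommGroup W] [Module ℝ W]

/-- Gram matrix of a bilinear form in a fixed basis of `V`. -/
def gram (g : V → V → ℝ) :
    Matrix (Fin (Module.finrank ℝ V)) (Fin (Module.finrank ℝ V)) ℝ :=
  Matrix.of fun i k => g (Module.finBasis ℝ V i) (Module.finBasis ℝ V k)

/-- The trace `g^{ik} B_{ik}` of a bilinear map `B` with respect to a nondegenerate form `g`
(independent of the basis). -/
def metricTrace (g : V → V → ℝ) (B : V → V → W) : W :=
  ∑ i, ∑ k, (gram g)⁻¹ i k • B (Module.finBasis ℝ V i) (Module.finBasis ℝ V k)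

/-- The vector `α^♯` with `g (α^♯, w) = α w`, for a linear form `α` and a nondegenerate symmetric
form `g`. -/
def sharp (g : V → V → ℝ) (α : V → ℝ) : V :=
  ∑ i, ∑ k, ((gram g)⁻¹ i k * α (Module.finBasis ℝ V k)) • Module.finBasis ℝ V i

end LinearAlgebra

/-! ## Levi-Civita connection and curvature of a metric on a domain of a vector space

`G y u v` is the value at the point `y` of the metric on the constant vectors `u`, `v`; `s` is the
ambient set in which derivatives are taken (the whole space or a half-space). -/

section Coordinates

variable {E : Type*} [NormedAddCommGroup E] [NormedSpace ℝ E] [FiniteDimensional ℝ E]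

/-- Christoffel symbols, `Γ^i_{kl} u^k v^l`. -/
def christoffel (G : E → E → E → ℝ) (s : Set E) (y u v : E) : E :=
  sharp (G y) fun z => (1 / 2 : ℝ) *
    (fderivWithin ℝ (fun y' => G y' v z) s y u + fderivWithin ℝ (fun y' => G y' u z) s y v
      - fderivWithin ℝ (fun y' => G y' u v) s y z)

/-- Curvature `R(u,v)w = ∇_u ∇_v w - ∇_v ∇_u w` on constant vectors. -/
def curvature (G : E → E → E → ℝ) (s : Set E) (y u v w : E) : E :=
  fderivWithin ℝ (fun y' => christoffel G s y' v w) s y u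
    - fderivWithin ℝ (fun y' => christoffel G s y' u w) s y v
    + christoffel G s y u (christoffel G s y v w)
    - christoffel G s y v (christoffel G s y u w)

/-- Ricci curvature `Ric(v,w) = tr (u ↦ R(u,v)w)`. -/
def ricciCoord (G : E → E → E → ℝ) (s : Set E) (y v w : E) : ℝ :=
  ∑ i, (Module.finBasis ℝ E).coord i (curvature G s y (Module.finBasis ℝ E i) v w)

end Coordinates

/-! ## Metrics on manifolds with boundary -/

section Manifolds

variable {E : Type*} [NormedAddCommGroup E] [NormedSpace ℝ E]
  {H : Type*} [TopologicalSpace H] (I : ModelWithCorners ℝ E H)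
  {M : Type*} [TopologicalSpace M] [ChartedSpace H M]
  {F : Type*} [NormedAddCommGroup F] [NormedSpace ℝ F]
  {K : Type*} [TopologicalSpace K] (J : ModelWithCorners ℝ F K)
  {N : Type*} [TopologicalSpace N] [ChartedSpace K N]

/-- Fields of (continuous) bilinear forms on the tangent spaces of a manifold. -/
abbrev FormField (M : Type*) [TopologicalSpace M] [ChartedSpace H M] :=
  ∀ p : M, TangentSpace I p →L[ℝ] TangentSpace I p →L[ℝ] ℝ

variable {I J}

/-- Coordinate expression of a field of bilinear forms in the preferred chart at `x`. -/
def chartForm (g : FormField I M) (x : M) (y u v : E) : ℝ :=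
  g ((extChartAt I x).symm y)
    (mfderivWithin 𝓘(ℝ, E) I (extChartAt I x).symm (range I) y u)
    (mfderivWithin 𝓘(ℝ, E) I (extChartAt I x).symm (range I) y v)

/-- Smoothness: all components in all preferred charts are smooth. -/
def IsSmoothForm (g : FormField I M) : Prop :=
  ∀ (x : M) (u v : E), ContDiffOn ℝ ∞ (fun y => chartForm g x y u v) (extChartAt I x).target

def IsSymmForm (g : FormField I M) : Prop :=
  ∀ (p : M) (u v : TangentSpace I p), g p u v = g p v u

/-- Smooth Riemannian metrics. -/
structure IsRiemannian (g : FormField I M) : Prop where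
  smooth : IsSmoothForm g
  symm : IsSymmForm g
  pos : ∀ (p : M) (v : TangentSpace I p), v ≠ 0 → 0 < g p v v

/-- Smooth Lorentz metrics, of signature `(-,+,...,+)`. -/
structure IsLorentz (g : FormField I M) : Prop where
  smooth : IsSmoothForm g
  symm : IsSymmForm g
  signature : ∀ p : M, ∃ v : TangentSpace I p, g p v v < 0 ∧
    ∀ w : TangentSpace I p, g p v w = 0 → w ≠ 0 → 0 < g p w w

/-- The pullback `f^* h`. -/
def pullbackForm (f : M → N) (h : FormField J N) : FormField I M :=
  fun p =>
    let b : F →L[ℝ] F →L[ℝ] ℝ := h (f p)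
    let f' : E →L[ℝ] F := mfderiv I J f p
    let r : E →L[ℝ] E →L[ℝ] ℝ := b.bilinearComp f' f'
    r

/-- Second derivative at `p` of the expression of `f` in the preferred charts at `p` and `f p`. -/
def chartSecondDeriv (f : M → N) (p : M) (u v : TangentSpace I p) : TangentSpace J (f p) :=
  let f' : E → F := writtenInExtChartAt I J p f
  let u' : E := u
  let v' : E := v
  let r : F :=
    fderivWithin ℝ (fun y => fderivWithin ℝ f' (range I) y v') (range I) (extChartAt I p p) u'
  r

variable [FiniteDimensional ℝ E] [FiniteDimensional ℝ F]

/-- Christoffel symbols at `p` in the preferred chart at `p`. -/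
def christoffelAt (g : FormField I M) (p : M) (u v : TangentSpace I p) : TangentSpace I p :=
  christoffel (E := E) (chartForm g p) (range I) (extChartAt I p p) u v

/-- The Ricci tensor. -/
def ricci (g : FormField I M) (p : M) (v w : TangentSpace I p) : ℝ :=
  ricciCoord (E := E) (chartForm g p) (range I) (extChartAt I p p) v w

def IsRicciFlat (g : FormField I M) : Prop :=
  ∀ (p : M) (v w : TangentSpace I p), ricci g p v w = 0

/-- The gradient of a function. -/
def gradient (g : FormField I M) (f : M → ℝ) (p : M) : TangentSpace I p :=
  let df : E → ℝ := fun v => mfderiv I 𝓘(ℝ, ℝ) f p v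
  (sharp (V := E) (fun u v => g p u v) df : E)

/-- The Hessian of a function. -/
def hessian (g : FormField I M) (f : M → ℝ) (p : M) (u v : TangentSpace I p) : ℝ :=
  let d2 : ℝ := chartSecondDeriv (J := 𝓘(ℝ, ℝ)) f p u v
  let d1 : ℝ := mfderiv I 𝓘(ℝ, ℝ) f p (christoffelAt g p u v)
  d2 - d1

/-- The second covariant derivative `∇df (u,v)` of a map `f : (M,g) → (N,h)`. -/
def mapHessian (g : FormField I M) (h : FormField J N) (f : M → N) (p : M)
    (u v : TangentSpace I p) : TangentSpace J (f p) :=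
  chartSecondDeriv f p u v - mfderiv I J f p (christoffelAt g p u v)
    + christoffelAt h (f p) (mfderiv I J f p u) (mfderiv I J f p v)

/-- The tension field `tr_g ∇df`, in coordinates
`(□_g f)^a + Γ^a_{bc}(f) g^{ik} ∂_i f^b ∂_k f^c`. -/
def tension (g : FormField I M) (h : FormField J N) (f : M → N) (p : M) : TangentSpace J (f p) :=
  let B : E → E → F := fun u v => mapHessian g h f p u v
  (metricTrace (fun u v : E => g p u v) B : F)

/-- Second fundamental form of an immersed hypersurface `f : M → (N,h)` with respect to the unit
normal `ν` at `f p`: `K(u,v) = h(∇_u ν, df v) = - h(ν, ∇_u df v)`, i.e. `2K = L_ν h`. -/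
def secondFundForm (h : FormField J N) (f : M → N) (p : M) (ν : TangentSpace J (f p))
    (u v : TangentSpace I p) : ℝ :=
  - h (f p) ν (chartSecondDeriv f p u v
      + christoffelAt h (f p) (mfderiv I J f p u) (mfderiv I J f p v))

/-- Covariant derivative in the direction `v` of a vector field `Y` along the map `f`. -/
def covDerivAlong (h : FormField J N) (f : M → N) (Y : ∀ x : M, TangentSpace J (f x))
    (p : M) (v : TangentSpace I p) : TangentSpace J (f p) :=
  let Y' : M → F := fun x => mfderiv J 𝓘(ℝ, F) (extChartAt J (f p)) (f x) (Y x)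
  let d : F := mfderiv I 𝓘(ℝ, F) Y' p v
  let y : F := christoffelAt h (f p) (mfderiv I J f p v) (Y p)
  (d + y : F)

/-! ### Distance to a set, and normal collars -/

/-- Length of the curve `c : [0,1] → M`. -/
def curveLength (g : FormField I M) (c : ℝ → M) : ℝ :=
  ∫ t in (0 : ℝ)..1, √(g (c t) (mfderivWithin 𝓘(ℝ, ℝ) I c (Icc 0 1) t (1 : ℝ))
    (mfderivWithin 𝓘(ℝ, ℝ) I c (Icc 0 1) t (1 : ℝ)))

/-- Riemannian distance to the boundary: infimum of the lengths of `C^1` curves from the boundary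
to the given point. -/
def distBoundary (g : FormField I M) (x : M) : ℝ :=
  sInf {L : ℝ | ∃ c : ℝ → M, ContMDiffOn 𝓘(ℝ, ℝ) I 1 c (Icc 0 1) ∧ c 0 ∈ I.boundary M ∧
    c 1 = x ∧ L = curveLength g c}

/-- The inward unit normal field of the equidistant foliation from the boundary. -/
def collarNormal (g : FormField I M) (x : M) : TangentSpace I x :=
  gradient g (distBoundary g) x

/-- A collar neighbourhood of the boundary on which the distance to the boundary is smooth, swept
out by the flow lines of `collarNormal` that start at the boundary. -/
structure IsNormalCollar (g : FormField I M) (U : Set M) : Prop where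
  isOpen : IsOpen U
  boundary_subset : I.boundary M ⊆ U
  smooth : ContMDiffOn I 𝓘(ℝ, ℝ) ∞ (distBoundary g) U
  flow : ∀ x ∈ U, ∃ (c : ℝ → M) (a : ℝ), 0 ≤ a ∧ c 0 ∈ I.boundary M ∧ c a = x ∧
    (∀ t ∈ Icc 0 a, c t ∈ U) ∧ IsMIntegralCurveOn c (collarNormal g) (Icc 0 a)

/-! ### Causality -/

/-- Future-pointing causal vectors; the time orientation is given by a timelike field `X`. -/
def IsFutureCausal (g : FormField I M) (X : ∀ p : M, TangentSpace I p) (p : M)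
    (v : TangentSpace I p) : Prop :=
  v ≠ 0 ∧ g p v v ≤ 0 ∧ g p v (X p) < 0

/-- Future-pointing timelike vectors. -/
def IsFutureTimelike (g : FormField I M) (X : ∀ p : M, TangentSpace I p) (p : M)
    (v : TangentSpace I p) : Prop :=
  g p v v < 0 ∧ g p v (X p) < 0

/-- Piecewise `C^1` curves on the interval `D` all of whose one-sided velocities satisfy `P`. -/
def IsPiecewiseCurve (P : ∀ p : M, TangentSpace I p → Prop) (c : ℝ → M) (D : Set ℝ) : Prop :=
  ∀ t ∈ D, ∀ s ∈ D,
    (t < s → ContMDiffWithinAt 𝓘(ℝ, ℝ) I 1 c (Icc t s) t ∧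
      P (c t) (mfderivWithin 𝓘(ℝ, ℝ) I c (Icc t s) t (1 : ℝ))) ∧
    (s < t → ContMDiffWithinAt 𝓘(ℝ, ℝ) I 1 c (Icc s t) t ∧
      P (c t) (mfderivWithin 𝓘(ℝ, ℝ) I c (Icc s t) t (1 : ℝ)))

/-- The causal relation `p ≤ q`, i.e. `q ∈ J⁺(p)`. -/
def CausallyPrecedes (g : FormField I M) (X : ∀ p : M, TangentSpace I p) (p q : M) : Prop :=
  p = q ∨ ∃ (c : ℝ → M) (a b : ℝ), a < b ∧ c a = p ∧ c b = q ∧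
    IsPiecewiseCurve (IsFutureCausal g X) c (Icc a b)

/-- Global hyperbolicity: there are no closed causal curves, and the causal diamonds
`J⁺(p) ∩ J⁻(q)` are compact. -/
structure IsGloballyHyperbolic (g : FormField I M) (X : ∀ p : M, TangentSpace I p) : Prop where
  causal : ∀ (c : ℝ → M) (a b : ℝ), a < b → IsPiecewiseCurve (IsFutureCausal g X) c (Icc a b) →
    c a ≠ c b
  compact_diamond : ∀ p q : M,
    IsCompact {r : M | CausallyPrecedes g X p r ∧ CausallyPrecedes g X r q}

/-- Cauchy hypersurfaces: every inextendible future-directed timelike curve (parametrized by an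
open interval, without loss of generality `ℝ`) meets the set exactly once. -/
def IsCauchy (g : FormField I M) (X : ∀ p : M, TangentSpace I p) (A : Set M) : Prop :=
  ∀ c : ℝ → M, IsPiecewiseCurve (IsFutureTimelike g X) c univ →
    (¬ ∃ p, Tendsto c atTop (𝓝 p)) → (¬ ∃ p, Tendsto c atBot (𝓝 p)) → ∃! t, c t ∈ A

/-- `f` is a time function on `A`: it strictly increases along future-directed causal curves. -/
def IsTimeFunctionOn (g : FormField I M) (X : ∀ p : M, TangentSpace I p) (f : M → ℝ)
    (A : Set M) : Prop :=
  ContinuousOn f A ∧ ∀ (c : ℝ → M) (a b : ℝ), a < b → (∀ t ∈ Icc a b, c t ∈ A) →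
    IsPiecewiseCurve (IsFutureCausal g X) c (Icc a b) → f (c a) < f (c b)

end Manifolds

/-! ## The fixed background -/

/-- The model of the cylinder `M₀ = ℝ × S`. -/
abbrev cylModel : ModelWithCorners ℝ (ℝ × EuclideanSpace ℝ (Fin 3))
    (ModelProd ℝ (EuclideanHalfSpace 3)) := 𝓘(ℝ, ℝ).prod (𝓡∂ 3)

/-- The model of the boundary cylinder `C₀ = ℝ × Σ`. -/
abbrev bdryModel : ModelWithCorners ℝ (ℝ × EuclideanSpace ℝ (Fin 2))
    (ModelProd ℝ (EuclideanSpace ℝ (Fin 2))) := 𝓘(ℝ, ℝ).prod (𝓡 2)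

/-- The first coordinate of a tangent vector of an `n`-manifold with boundary at a boundary point:
it vanishes iff the vector is tangent to the boundary, and is positive (negative) iff the vector
points strictly inwards (outwards). -/
def normalCoord {n : ℕ} [NeZero n] {M : Type*} [TopologicalSpace M]
    [ChartedSpace (EuclideanHalfSpace n) M] {p : M} (v : TangentSpace (𝓡∂ n) p) : ℝ :=
  (show EuclideanSpace ℝ (Fin n) from v) 0

section Surface

variable {Sig : Type*} [TopologicalSpace Sig] [ChartedSpace (EuclideanSpace ℝ (Fin 2)) Sig]

local instance fact_finrank_three :
    Fact (Module.finrank ℝ (EuclideanSpace ℝ (Fin 3)) = 2 + 1) := ⟨by simp⟩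

/-- The open subset `V` of a surface is diffeomorphic to the two-sphere. -/
def IsSphere (V : TopologicalSpace.Opens Sig) : Prop :=
  Nonempty (V ≃ₘ^∞⟮𝓡 2, 𝓡 2⟯ Metric.sphere (0 : EuclideanSpace ℝ (Fin 3)) 1)

/-- The open subset `V` of a surface is diffeomorphic to the two-torus. -/
def IsTorus (V : TopologicalSpace.Opens Sig) : Prop :=
  Nonempty (V ≃ₘ^∞⟮𝓡 2, (𝓡 1).prod (𝓡 1)⟯ (Circle × Circle))

/-- The base points of the group `Diff'(Σ)`: three on each spherical component, one on each
toroidal component and none on the other components. -/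
def IsBasePoints (P : Set Sig) : Prop :=
  ∀ (V : TopologicalSpace.Opens Sig) (y : Sig), (V : Set Sig) = connectedComponent y →
    (IsSphere V → (P ∩ V).ncard = 3) ∧ (IsTorus V → (P ∩ V).ncard = 1) ∧
    (¬ IsSphere V → ¬ IsTorus V → P ∩ V = ∅)

/-- The group `Diff'(Σ)`: diffeomorphisms smoothly isotopic to the identity and fixing the base
points. -/
def IsDiffPrime (P : Set Sig) (Φ : Sig ≃ₘ^∞⟮𝓡 2, 𝓡 2⟯ Sig) : Prop :=
  (∀ y ∈ P, Φ y = y) ∧ ∃ F : ℝ × Sig → Sig, ContMDiff bdryModel (𝓡 2) ∞ F ∧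
    (∀ t, ∃ D : Sig ≃ₘ^∞⟮𝓡 2, 𝓡 2⟯ Sig, ∀ y, F (t, y) = D y) ∧
    (∀ y, F (0, y) = y) ∧ (∀ y, F (1, y) = Φ y)

/-- `σ = Φ^*(λ² σ₀)` for some positive smooth function `λ`. -/
def IsConformalPullback (Φ : Sig ≃ₘ^∞⟮𝓡 2, 𝓡 2⟯ Sig) (σ σ₀ : FormField (𝓡 2) Sig) : Prop :=
  ∃ l : Sig → ℝ, ContMDiff (𝓡 2) 𝓘(ℝ, ℝ) ∞ l ∧ (∀ y, 0 < l y) ∧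
    ∀ (y : Sig) (u v : TangentSpace (𝓡 2) y), σ y u v = l (Φ y) ^ 2 *
      σ₀ (Φ y) (mfderiv (𝓡 2) (𝓡 2) Φ y u) (mfderiv (𝓡 2) (𝓡 2) Φ y v)

/-- Space-form metrics: constant Gauss curvature `1`, `0` or `-1` on each component. -/
def IsSpaceForm (σ : FormField (𝓡 2) Sig) : Prop :=
  IsRiemannian σ ∧ ∃ k : Sig → ℝ, IsLocallyConstant k ∧
    ∀ y, (k y = 1 ∨ k y = 0 ∨ k y = -1) ∧
      ∀ v w : TangentSpace (𝓡 2) y, ricci σ y v w = k y * σ y v w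

end Surface

variable (S : Type*) [TopologicalSpace S] [ChartedSpace (EuclideanHalfSpace 3) S]
  [IsManifold (𝓡∂ 3) ∞ S]
  (Sig : Type*) [TopologicalSpace Sig] [ChartedSpace (EuclideanSpace ℝ (Fin 2)) Sig]
  [IsManifold (𝓡 2) ∞ Sig]

/-- The fixed choices: the identification of `Σ` with `∂S`; the time function `t₀` and the
Riemannian metric `g_R` on `M₀ = ℝ × S`; the base points and the slice of space-form metrics which
fix the uniformizing diffeomorphisms of `Σ`; the boundary gauge `Θ` on `C₀ = ℝ × Σ`; and the
coefficients of the mean curvature term. -/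
structure Background where
  /-- the embedding of `Σ` onto `∂S` -/
  bd : Sig → S
  bd_embedding : IsSmoothEmbedding (𝓡 2) (𝓡∂ 3) ∞ bd
  range_bd : range bd = (𝓡∂ 3).boundary S
  /-- the time function of `M₀` -/
  t₀ : ℝ × S → ℝ
  t₀_smooth : ContMDiff cylModel 𝓘(ℝ, ℝ) ∞ t₀
  t₀_increasing : ∀ q : ℝ × S, 0 < (show ℝ from mfderiv cylModel 𝓘(ℝ, ℝ) t₀ q
    (show ℝ × EuclideanSpace ℝ (Fin 3) from (1, 0)))
  t₀_eq_zero : ∀ q : ℝ × S, t₀ q = 0 ↔ q.1 = 0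
  /-- the Riemannian metric of `M₀` -/
  gR : FormField cylModel (ℝ × S)
  gR_riemannian : IsRiemannian gR
  /-- `S₀` and `C₀` are perpendicular along the corner: the vectors normal to `S₀` are tangent to
  `C₀` -/
  gR_perp : ∀ (y : Sig) (T : TangentSpace cylModel ((0 : ℝ), bd y)),
    (∀ w : EuclideanSpace ℝ (Fin 3), gR (0, bd y) T
      (show ℝ × EuclideanSpace ℝ (Fin 3) from (0, w)) = 0) →
    (show ℝ × EuclideanSpace ℝ (Fin 3) from T).2 0 = 0
  /-- the base points on `Σ` -/
  basePts : Set Sig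
  basePts_spec : IsBasePoints basePts
  /-- the slice of space-form metrics on `Σ` -/
  slice : Set (FormField (𝓡 2) Sig)
  slice_spaceForm : ∀ σ ∈ slice, IsSpaceForm σ
  /-- a slice meets every orbit of `Diff'(Σ)` and the conformal changes at most once, and
  freely -/
  slice_transversal : ∀ σ ∈ slice, ∀ σ' ∈ slice, ∀ Φ : Sig ≃ₘ^∞⟮𝓡 2, 𝓡 2⟯ Sig,
    IsDiffPrime basePts Φ → IsConformalPullback Φ σ σ' → ∀ y, Φ y = y
  /-- the boundary gauge, a vector field on `C₀` -/
  Θ : ∀ q : ℝ × Sig, TangentSpace bdryModel q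
  Θ_smooth : ContMDiff bdryModel bdryModel.tangent ∞
    (fun q => (⟨q, Θ q⟩ : TangentBundle bdryModel (ℝ × Sig)))
  a : ℝ
  b : ℝ
  c : ℝ

variable {S Sig}

namespace Background

variable (B : Background S Sig)

/-- The inclusion `C₀ = ℝ × Σ → M₀ = ℝ × S`. -/
def incl (q : ℝ × Sig) : ℝ × S := (q.1, B.bd q.2)

/-- The surface `Υ = S₀ ∪ C₀` in `M₀`. -/
def surface : Set (ℝ × S) := {q | q.1 = 0} ∪ range B.incl

/-- The tangent space of the leaf `Σ_τ = {t₀ = τ}` of `C₀`. -/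
def leafTangent (q : ℝ × Sig) : Submodule ℝ (ℝ × EuclideanSpace ℝ (Fin 2)) :=
  LinearMap.ker (show (ℝ × EuclideanSpace ℝ (Fin 2)) →L[ℝ] ℝ from
    mfderiv bdryModel 𝓘(ℝ, ℝ) (B.t₀ ∘ B.incl) q).toLinearMap

/-- The metric induced by `g_R` on `S₀`, identified with `S`. -/
def gRS : FormField (𝓡∂ 3) S := pullbackForm (fun x : S => ((0 : ℝ), x)) B.gR

/-- `T` is the future-pointing `g_R`-unit normal of `S₀` at the point `(0,x)`. -/
def IsSliceNormal (x : S) (T : TangentSpace cylModel ((0 : ℝ), x)) : Prop :=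
  B.gR (0, x) T T = 1 ∧
  (∀ w : EuclideanSpace ℝ (Fin 3),
    B.gR (0, x) T (show ℝ × EuclideanSpace ℝ (Fin 3) from (0, w)) = 0) ∧
  0 < (show ℝ × EuclideanSpace ℝ (Fin 3) from T).1

/-- `Φ` is the uniformizing diffeomorphism `Φ_σ` in `Diff'(Σ)` of the metric `σ`: up to a conformal
factor, `(Φ⁻¹)^*σ` belongs to the slice of space-form metrics. -/
def IsUniformizing (σ : FormField (𝓡 2) Sig) (Φ : Sig ≃ₘ^∞⟮𝓡 2, 𝓡 2⟯ Sig) : Prop :=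
  IsDiffPrime B.basePts Φ ∧ ∃ σ₀ ∈ B.slice, IsConformalPullback Φ σ σ₀

/-- `e` is the map `E_γ : U → S₀` associated to the Riemannian metric `γ` of `S` on the collar `U`:
it is the uniformizing diffeomorphism of the induced metric on `Σ`, and it maps the normal field of
the equidistant foliation of `γ` to that of the metric induced by `g_R`. -/
structure IsCollarMap (γ : FormField (𝓡∂ 3) S) (U : Set S) (e : S → S) : Prop where
  collar : IsNormalCollar γ U
  smooth : ContMDiffOn (𝓡∂ 3) (𝓡∂ 3) ∞ e U
  target : ∃ U', IsNormalCollar B.gRS U' ∧ MapsTo e U U'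
  on_corner : ∃ Φ : Sig ≃ₘ^∞⟮𝓡 2, 𝓡 2⟯ Sig, B.IsUniformizing (pullbackForm B.bd γ) Φ ∧
    ∀ y, e (B.bd y) = B.bd (Φ y)
  normal : ∀ x ∈ U, mfderiv (𝓡∂ 3) (𝓡∂ 3) e x (collarNormal γ x) = collarNormal B.gRS (e x)

end Background

/-- Initial data `(γ, κ)` on `S` and boundary data `([σ], H)` on `C₀`. The conformal class `[σ]` of
the leaves `Σ_τ` is represented by a field of bilinear forms on `C₀` that is positive definite on
the tangent spaces of the leaves. -/
structure InitialBoundaryData (B : Background S Sig) where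
  γ : FormField (𝓡∂ 3) S
  γ_riemannian : IsRiemannian γ
  κ : FormField (𝓡∂ 3) S
  κ_smooth : IsSmoothForm κ
  κ_symm : IsSymmForm κ
  σ : FormField bdryModel (ℝ × Sig)
  σ_smooth : IsSmoothForm σ
  σ_symm : IsSymmForm σ
  σ_pos : ∀ (q : ℝ × Sig) (v : TangentSpace bdryModel q), v ∈ B.leafTangent q → v ≠ 0 →
    0 < σ q v v
  H : ℝ × Sig → ℝ
  H_smooth : ContMDiff bdryModel 𝓘(ℝ, ℝ) ∞ H

/-! ## The associated wave map -/

section WaveMap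

variable {M : Type*} [TopologicalSpace M] [ChartedSpace (EuclideanHalfSpace 4) M]
  [IsManifold (𝓡∂ 4) ∞ M]

/-- `ν` is the outward unit normal to the boundary of `(M,g)` at `p`. -/
def IsOutwardNormal (g : FormField (𝓡∂ 4) M) (p : M) (ν : TangentSpace (𝓡∂ 4) p) : Prop :=
  g p ν ν = 1 ∧ (∀ w : TangentSpace (𝓡∂ 4) p, normalCoord w = 0 → g p ν w = 0) ∧
  normalCoord ν < 0

variable (B : Background S Sig)

/-- `T` is the future-pointing unit vector tangent to the boundary of `(M,g)` at `p` and normal,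
within the boundary, to the level set of `t₀ ∘ φ`. -/
def IsLeafNormal (g : FormField (𝓡∂ 4) M) (X : ∀ p : M, TangentSpace (𝓡∂ 4) p) (φ : M → ℝ × S)
    (p : M) (T : TangentSpace (𝓡∂ 4) p) : Prop :=
  normalCoord T = 0 ∧ g p T T = -1 ∧ g p T (X p) < 0 ∧
  ∀ w : TangentSpace (𝓡∂ 4) p, normalCoord w = 0 →
    mfderiv (𝓡∂ 4) 𝓘(ℝ, ℝ) (B.t₀ ∘ φ) p w = 0 → g p T w = 0

/-- `φ` is the wave map associated to the time-oriented Lorentz metric `g` on the neighbourhood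
`φ.source` of the boundary, and a diffeomorphism onto its image. Here `i : S → M` is the embedding
of the initial surface. -/
structure IsAssociatedWaveMap (g : FormField (𝓡∂ 4) M) (X : ∀ p : M, TangentSpace (𝓡∂ 4) p)
    (i : S → M) (φ : OpenPartialHomeomorph M (ℝ × S)) : Prop where
  boundary_subset : (𝓡∂ 4).boundary M ⊆ φ.source
  smooth : ContMDiffOn (𝓡∂ 4) cylModel ∞ φ φ.source
  smooth_symm : ContMDiffOn cylModel (𝓡∂ 4) ∞ φ.symm φ.target
  /-- the wave map equation -/
  wave : ∀ p ∈ φ.source, tension g B.gR φ p = 0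
  /-- the initial conditions: with `γ` the induced metric on the initial surface, `φ = E_γ` and
  `φ_* N = T_{g_R}`. At the corner, `N` is the future unit normal of the corner within the boundary
  of `M`; it is extended by parallel transport along the flow of the normal field of the
  equidistant foliation. -/
  initial : ∃ (U : Set S) (e : S → S) (N : ∀ x : S, TangentSpace (𝓡∂ 4) (i x)),
    B.IsCollarMap (pullbackForm i g) U e ∧ (∀ x, i x ∈ φ.source → x ∈ U) ∧
    (∀ x, i x ∈ φ.source → φ (i x) = (0, e x)) ∧
    ContMDiffOn (𝓡∂ 3) (𝓡∂ 4).tangent ∞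
      (fun x => (⟨i x, N x⟩ : TangentBundle (𝓡∂ 4) M)) U ∧
    (∀ y : Sig, normalCoord (N (B.bd y)) = 0 ∧
      g (i (B.bd y)) (N (B.bd y)) (N (B.bd y)) = -1 ∧
      g (i (B.bd y)) (N (B.bd y)) (X (i (B.bd y))) < 0 ∧
      ∀ w : TangentSpace (𝓡 2) y,
        g (i (B.bd y)) (N (B.bd y)) (mfderiv (𝓡 2) (𝓡∂ 4) (i ∘ B.bd) y w) = 0) ∧
    (∀ x ∈ U, covDerivAlong (I := 𝓡∂ 3) g i N x (collarNormal (pullbackForm i g) x) = 0) ∧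
    ∀ x, i x ∈ φ.source →
      B.IsSliceNormal (e x) (mfderiv (𝓡∂ 4) cylModel φ (i x) (N x))
  /-- the boundary conditions: `φ` maps the boundary into `C₀`, and `Θ` is the `g_R`-orthogonal
  projection to `C₀` of `φ_*(T + ν)` -/
  boundary : ∀ p ∈ (𝓡∂ 4).boundary M, ∃ q : ℝ × Sig, φ p = B.incl q ∧
    ∃ T ν : TangentSpace (𝓡∂ 4) p, IsLeafNormal B g X φ p T ∧ IsOutwardNormal g p ν ∧
      ∀ w : TangentSpace bdryModel q, B.gR (B.incl q)
        (show ℝ × EuclideanSpace ℝ (Fin 3) from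
          (show ℝ × EuclideanSpace ℝ (Fin 3) from mfderiv (𝓡∂ 4) cylModel φ p (T + ν))
            - (show ℝ × EuclideanSpace ℝ (Fin 3) from
                mfderiv bdryModel cylModel B.incl q (B.Θ q)))
        (mfderiv bdryModel cylModel B.incl q w) = 0

variable {B}

/-- The boundary conditions `[h^⊺] = [σ]` and `H_h = H` at the point `q` of `C₀`, for a Lorentz
metric `h` defined near `q` in `M₀`. -/
structure BoundaryConditions (d : InitialBoundaryData B) (h : FormField cylModel (ℝ × S))
    (q : ℝ × Sig) : Prop where
  conformal : ∃ l : ℝ, 0 < l ∧ ∀ u ∈ B.leafTangent q, ∀ v ∈ B.leafTangent q,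
    pullbackForm (I := bdryModel) B.incl h q u v = l * d.σ q u v
  /-- `H = a tr_{Σ_τ} K_{S_τ} + b tr_{C₀} K_{C₀} + c tr_{Σ_τ} K_{C₀}`; `ν` is the outward unit
  normal of `C₀` and `N` the future unit normal of the level set `S_τ` of `t₀`, so that
  `K_{S_τ} = - Hess t₀ / dt₀(N)`. -/
  mean : ∃ ν N : TangentSpace cylModel (B.incl q),
    h (B.incl q) ν ν = 1 ∧
    (∀ w : TangentSpace bdryModel q,
      h (B.incl q) ν (mfderiv bdryModel cylModel B.incl q w) = 0) ∧
    (show ℝ × EuclideanSpace ℝ (Fin 3) from ν).2 0 < 0 ∧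
    h (B.incl q) N N = -1 ∧
    (∀ w : TangentSpace cylModel (B.incl q),
      mfderiv cylModel 𝓘(ℝ, ℝ) B.t₀ (B.incl q) w = 0 → h (B.incl q) N w = 0) ∧
    0 < (show ℝ from mfderiv cylModel 𝓘(ℝ, ℝ) B.t₀ (B.incl q) N) ∧
    (let hC : (ℝ × EuclideanSpace ℝ (Fin 2)) → (ℝ × EuclideanSpace ℝ (Fin 2)) → ℝ :=
      fun u v => pullbackForm (I := bdryModel) B.incl h q u v
    let KC : (ℝ × EuclideanSpace ℝ (Fin 2)) → (ℝ × EuclideanSpace ℝ (Fin 2)) → ℝ :=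
      fun u v => secondFundForm (I := bdryModel) h B.incl q ν u v
    let KS : (ℝ × EuclideanSpace ℝ (Fin 2)) → (ℝ × EuclideanSpace ℝ (Fin 2)) → ℝ :=
      fun u v => - hessian h B.t₀ (B.incl q) (mfderiv bdryModel cylModel B.incl q u)
        (mfderiv bdryModel cylModel B.incl q v)
        / (show ℝ from mfderiv cylModel 𝓘(ℝ, ℝ) B.t₀ (B.incl q) N)
    d.H q = B.a * metricTrace (fun u v : B.leafTangent q => hC u v)
          (fun u v : B.leafTangent q => KS u v)
        + B.b * metricTrace hC KC
        + B.c * metricTrace (fun u v : B.leafTangent q => hC u v)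
          (fun u v : B.leafTangent q => KC u v))

end WaveMap

/-! ## Vacuum developments and extensions -/

/-- The interval `(-1,1)`. -/
abbrev symInterval : TopologicalSpace.Opens ℝ := ⟨Ioo (-1) 1, isOpen_Ioo⟩

/-- A vacuum development, with underlying manifold `M ≅ (-1,1) × S`, of the initial-boundary data
`d`. -/
structure VacuumDevelopment {B : Background S Sig} (d : InitialBoundaryData B) (M : Type*)
    [TopologicalSpace M] [ChartedSpace (EuclideanHalfSpace 4) M] [IsManifold (𝓡∂ 4) ∞ M] where
  product : Nonempty (M ≃ₘ^∞⟮𝓡∂ 4, cylModel⟯ (symInterval × S))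
  /-- the Lorentz metric -/
  g : FormField (𝓡∂ 4) M
  lorentz : IsLorentz g
  /-- a timelike vector field giving the time orientation -/
  X : ∀ p : M, TangentSpace (𝓡∂ 4) p
  X_continuous : Continuous (fun p => (⟨p, X p⟩ : TangentBundle (𝓡∂ 4) M))
  X_timelike : ∀ p, g p (X p) (X p) < 0
  ricciFlat : IsRicciFlat g
  /-- the boundary is timelike -/
  timelike_boundary : ∀ p ∈ (𝓡∂ 4).boundary M, ∃ v : TangentSpace (𝓡∂ 4) p,
    normalCoord v = 0 ∧ g p v v < 0
  globallyHyperbolic : IsGloballyHyperbolic g X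
  /-- the subdomain `Υ'` of the surface `Υ = S₀ ∪ C₀` -/
  dom : Set (ℝ × S)
  dom_subset : dom ⊆ B.surface
  dom_open : ∃ V : Set (ℝ × S), IsOpen V ∧ dom = V ∩ B.surface
  dom_connected : IsConnected dom
  slice_subset_dom : ∀ x : S, ((0 : ℝ), x) ∈ dom
  /-- the embedding of `Υ'` into `M`; only its values on `Υ'` matter -/
  ι : ℝ × S → M
  ι_embedding : IsEmbedding (dom.domRestrict ι)
  ι_slice : IsSmoothEmbedding (𝓡∂ 3) (𝓡∂ 4) ∞ (fun x : S => ι (0, x))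
  ι_boundary_smooth : ContMDiffOn bdryModel (𝓡∂ 4) ∞ (ι ∘ B.incl) (B.incl ⁻¹' dom)
  ι_boundary_immersion : ∀ q ∈ B.incl ⁻¹' dom,
    Function.Injective (mfderiv bdryModel (𝓡∂ 4) (ι ∘ B.incl) q)
  ι_image_boundary : ι '' (dom ∩ range B.incl) = (𝓡∂ 4).boundary M
  /-- the initial surface is a Cauchy hypersurface -/
  cauchy : IsCauchy g X (range fun x : S => ι (0, x))
  /-- the initial conditions: induced metric and second fundamental form -/
  induced_metric : pullbackForm (fun x : S => ι (0, x)) g = d.γ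
  induced_secondFundForm : ∀ x : S, ∃ N : TangentSpace (𝓡∂ 4) (ι (0, x)),
    g (ι (0, x)) N N = -1 ∧ g (ι (0, x)) N (X (ι (0, x))) < 0 ∧
    (∀ w : TangentSpace (𝓡∂ 3) x,
      g (ι (0, x)) N (mfderiv (𝓡∂ 3) (𝓡∂ 4) (fun x : S => ι (0, x)) x w) = 0) ∧
    ∀ u v : TangentSpace (𝓡∂ 3) x,
      secondFundForm (I := 𝓡∂ 3) g (fun x : S => ι (0, x)) x N u v = d.κ x u v
  /-- the wave map associated to `g`, on a neighbourhood of the boundary -/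
  φ : OpenPartialHomeomorph M (ℝ × S)
  φ_waveMap : IsAssociatedWaveMap B g X (fun x : S => ι (0, x)) φ
  /-- the boundary conditions, in the gauge `φ` -/
  boundaryConditions : ∀ q : ℝ × Sig, B.incl q ∈ φ '' (𝓡∂ 4).boundary M →
    BoundaryConditions d (pullbackForm φ.symm g) q
  /-- `t₀ ∘ φ` is a time function near the boundary -/
  timeFunction : ∃ V : Set M, IsOpen V ∧ (𝓡∂ 4).boundary M ⊆ V ∧ V ⊆ φ.source ∧
    IsTimeFunctionOn g X (B.t₀ ∘ φ) V
  /-- the boundary corresponds, under `φ`, to a slab `{τ₁ < t₀ < τ₂}` of `C₀` -/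
  slab : ∃ τ₁ τ₂ : EReal, τ₁ < 0 ∧ 0 < τ₂ ∧
    φ '' (𝓡∂ 4).boundary M = {p | p ∈ range B.incl ∧ τ₁ < (B.t₀ p : EReal) ∧ (B.t₀ p : EReal) < τ₂}

namespace VacuumDevelopment

variable {B : Background S Sig} {d : InitialBoundaryData B}
  {M : Type*} [TopologicalSpace M] [ChartedSpace (EuclideanHalfSpace 4) M]
  [IsManifold (𝓡∂ 4) ∞ M]
  {M' : Type*} [TopologicalSpace M'] [ChartedSpace (EuclideanHalfSpace 4) M']
  [IsManifold (𝓡∂ 4) ∞ M']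

/-- `Ψ` is an isometric embedding of `(M,g)` into `(M',g')` (being isometric, it is an immersion)
which is the identity of the initial surface and equals `φ'⁻¹ ∘ φ` on the boundary of `M`. -/
structure IsExtensionEmbedding (D : VacuumDevelopment d M) (D' : VacuumDevelopment d M')
    (Ψ : M → M') : Prop where
  smooth : ContMDiff (𝓡∂ 4) (𝓡∂ 4) ∞ Ψ
  embedding : IsEmbedding Ψ
  isometric : pullbackForm Ψ D'.g = D.g
  on_slice : ∀ x : S, Ψ (D.ι (0, x)) = D'.ι (0, x)
  on_boundary : ∀ p ∈ (𝓡∂ 4).boundary M, D.φ p ∈ D'.φ.target ∧ Ψ p = D'.φ.symm (D.φ p)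

/-- `(M',g')` is an extension of `(M,g)`. -/
def IsExtension (D : VacuumDevelopment d M) (D' : VacuumDevelopment d M') : Prop :=
  ∃ Ψ : M → M', D.IsExtensionEmbedding D' Ψ

end VacuumDevelopment

end IBVP

end

noncomputable section

set_option maxSynthPendingDepth 3

/-! An isometric immersion between nondegenerate metrics in equal dimensions is determined, on a
connected manifold, by its value and differential at a single point. Existence is the hypothesis, so
it suffices to find one point where the 1-jet of every admissible embedding is forced; any corner
point of the initial surface will do.

Rigidity comes from the transformation law of the Christoffel symbols. Differentiating `G = f^* G'`
and forming the Koszul combination gives the Hessian of `f` paired with the image of `Df`. By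
nondegeneracy this can be solved for `D²f`, so the jet `(f, Df)` satisfies a total differential
system with `C^1` right-hand side. Along segments in a chart this is an ODE, and two solutions with
the same initial value agree near that point (`second_derivative_of_isometry`,
`eventuallyEq_of_isometry`). Charts have convex ranges even at boundary points, so boundary points
need no separate treatment. The set where two isometries have equal germs is then open and closed
(`eq_of_isometric_of_jet`).

At a corner point the two maps agree on the initial surface and, nearby, on the timelike boundary.
Hence their differentials agree on two hyperplanes of the tangent space, one spacelike and one
containing a timelike vector. The hyperplanes are therefore distinct, and the differentials coincide
(`IsExtensionEmbedding.mfderiv_eq_at_corner`). -/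

namespace IBVP

/-! ### Uniqueness for total differential systems, by restriction to segments. -/

section TotalDifferentialSystems

variable {E : Type*} [NormedAddCommGroup E] [NormedSpace ℝ E]
  {X : Type*} [NormedAddCommGroup X] [NormedSpace ℝ X]

/-- Uniqueness for total differential systems `DF(y) = A(y, F(y))` with a `C^1` right-hand side, on
a convex set. -/
theorem eventuallyEq_of_total_differential {s : Set E} (hs : Convex ℝ s) {T : Set X}
    (hT : Convex ℝ T) {y₀ : E} (hy₀ : y₀ ∈ s) {x₀ : X} {A : E × X → E →L[ℝ] X}
    (hA : ContDiffWithinAt ℝ 1 A (s ×ˢ T) (y₀, x₀)) {F₁ F₂ : E → X}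
    (h₁ : ∀ᶠ y in 𝓝[s] y₀, F₁ y ∈ T ∧ HasFDerivWithinAt F₁ (A (y, F₁ y)) s y)
    (h₂ : ∀ᶠ y in 𝓝[s] y₀, F₂ y ∈ T ∧ HasFDerivWithinAt F₂ (A (y, F₂ y)) s y)
    (h₁₀ : F₁ y₀ = x₀) (h₂₀ : F₂ y₀ = x₀) :
    F₁ =ᶠ[𝓝[s] y₀] F₂ := by
  -- Convexity of `s ×ˢ T` turns `C^1` into a Lipschitz bound on a relative neighbourhood `t`; by
  -- continuity both graphs stay in `t` near `y₀`.
  obtain ⟨K, t, ht, hK⟩ := hA.exists_lipschitzOnWith (hs.prod hT)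
  have key : ∀ F : E → X, (∀ᶠ y in 𝓝[s] y₀, F y ∈ T ∧ HasFDerivWithinAt F (A (y, F y)) s y) →
      F y₀ = x₀ → ∀ᶠ y in 𝓝[s] y₀, (y, F y) ∈ t ∧ HasFDerivWithinAt F (A (y, F y)) s y := by
    intro F hF hF₀
    have hc : Tendsto (fun y => (y, F y)) (𝓝[s] y₀) (𝓝[s ×ˢ T] (y₀, x₀)) := by
      refine tendsto_nhdsWithin_iff.2 ⟨?_, ?_⟩
      · have := (hF.self_of_nhdsWithin hy₀).2.continuousWithinAt
        rw [← hF₀]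
        exact (continuousWithinAt_id.prodMk this)
      · filter_upwards [hF, self_mem_nhdsWithin] with y hy hys using ⟨hys, hy.1⟩
    filter_upwards [hc.eventually_mem ht, hF] with y h h' using ⟨h, h'.2⟩
  obtain ⟨r, hr, hball⟩ := Metric.mem_nhdsWithin_iff.1 ((key F₁ h₁ h₁₀).and (key F₂ h₂ h₂₀))
  refine Filter.mem_of_superset (inter_mem_nhdsWithin s (Metric.ball_mem_nhds y₀ hr)) ?_
  rintro y ⟨hys, hyr⟩
  -- The segment from `y₀` to `y` stays in `s` and in the ball, so each solution restricted to it
  -- solves the ODE `x' = A(c τ, x)(y - y₀)`. No integrability condition on `A` is needed for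
  -- uniqueness.
  set c : ℝ → E := fun τ => AffineMap.lineMap y₀ y τ with hc
  have hcmem : ∀ τ ∈ Icc (0 : ℝ) 1, c τ ∈ s ∩ Metric.ball y₀ r := by
    intro τ hτ
    exact (hs.inter (convex_ball y₀ r)).lineMap_mem ⟨hy₀, Metric.mem_ball_self hr⟩ ⟨hys, hyr⟩ hτ
  have hcd : ∀ τ, HasDerivAt c (y - y₀) τ := fun τ => AffineMap.hasDerivAt_lineMap
  have hder : ∀ F : E → X, (∀ z ∈ Metric.ball y₀ r ∩ s, HasFDerivWithinAt F (A (z, F z)) s z) →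
      ∀ τ ∈ Icc (0 : ℝ) 1,
        HasDerivWithinAt (F ∘ c) (A (c τ, F (c τ)) (y - y₀)) (Icc 0 1) τ := by
    intro F hF τ hτ
    exact (hF (c τ) (hcmem τ hτ).symm).comp_hasDerivWithinAt τ (hcd τ).hasDerivWithinAt
      (fun τ' hτ' => (hcmem τ' hτ').1)
  have d₁ := hder F₁ fun z hz => (hball hz).1.2
  have d₂ := hder F₂ fun z hz => (hball hz).2.2
  have hIci : ∀ {f : ℝ → X} {f' : X} {τ : ℝ}, τ ∈ Ico (0 : ℝ) 1 →
      HasDerivWithinAt f f' (Icc 0 1) τ → HasDerivWithinAt f f' (Ici τ) τ := by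
    intro f f' τ hτ h
    refine h.mono_of_mem_nhdsWithin ?_
    exact mem_of_superset (Icc_mem_nhdsGE hτ.2) (Icc_subset_Icc_left hτ.1)
  -- The Lipschitz constant picks up `‖y - y₀‖` because `A` is evaluated on that direction. The
  -- constraint set is the slice of `t` over `c τ`, hence depends on time.
  have huniq := ODE_solution_unique_of_mem_Icc_right (E := X) (K := K * ‖y - y₀‖₊)
    (v := fun τ x => A (c τ, x) (y - y₀)) (s := fun τ => {x | (c τ, x) ∈ t}) (a := 0) (b := 1)
    (f := F₁ ∘ c) (g := F₂ ∘ c) ?_ ?_ ?_ ?_ ?_ ?_ ?_ ?_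
  · have := huniq (right_mem_Icc.2 zero_le_one)
    simpa [hc] using this
  · intro τ _ x hx x' hx'
    have h := hK.dist_le_mul _ hx _ hx'
    rw [Prod.dist_eq, dist_self, max_eq_right dist_nonneg, dist_eq_norm] at h
    rw [edist_nndist, edist_nndist, ← ENNReal.coe_mul, ENNReal.coe_le_coe, ← NNReal.coe_le_coe]
    push_cast
    rw [dist_eq_norm, ← sub_apply]
    calc _ ≤ ‖A (c τ, x) - A (c τ, x')‖ * ‖y - y₀‖ := ContinuousLinearMap.le_opNorm _ _
      _ ≤ K * dist x x' * ‖y - y₀‖ := by gcongr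
      _ = _ := by ring
  · exact fun τ hτ => (d₁ τ hτ).continuousWithinAt
  · exact fun τ hτ => hIci hτ (d₁ τ (Ico_subset_Icc_self hτ))
  · exact fun τ hτ => (hball (hcmem τ (Ico_subset_Icc_self hτ)).symm).1.1
  · exact fun τ hτ => (d₂ τ hτ).continuousWithinAt
  · exact fun τ hτ => hIci hτ (d₂ τ (Ico_subset_Icc_self hτ))
  · exact fun τ hτ => (hball (hcmem τ (Ico_subset_Icc_self hτ)).symm).2.1
  · simp [hc, h₁₀, h₂₀]

end TotalDifferentialSystems

/-! ### The second derivative of an isometric immersion. -/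

section Rigidity

variable {E : Type*} [NormedAddCommGroup E] [NormedSpace ℝ E]
  {F : Type*} [NormedAddCommGroup F] [NormedSpace ℝ F]

theorem contDiffWithinAt_clm_of_apply {D : Type*} [NormedAddCommGroup D] [NormedSpace ℝ D]
    [FiniteDimensional ℝ E] {n : ℕ∞ω} {f : D → E →L[ℝ] F} {s : Set D} {x : D}
    (h : ∀ v, ContDiffWithinAt ℝ n (fun y => f y v) s x) : ContDiffWithinAt ℝ n f s x := by
  have hd : Module.finrank ℝ E = Module.finrank ℝ (Fin (Module.finrank ℝ E) → ℝ) := by simp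
  let e₁ := ContinuousLinearEquiv.ofFinrankEq hd
  let e₂ := (e₁.arrowCongr (1 : F ≃L[ℝ] F)).trans
    (ContinuousLinearEquiv.piRing (Fin (Module.finrank ℝ E)))
  rw [← Function.id_comp f, ← e₂.symm_comp_self]
  exact e₂.symm.contDiff.contDiffAt.comp_contDiffWithinAt x
    (contDiffWithinAt_pi.mpr fun i => h _)

/-- The Christoffel symbols of the first kind `½ (D_u(v,w) + D_v(u,w) - D_w(u,v))` of a metric with
derivative `D`. -/
def koszul (D : E →L[ℝ] E →L[ℝ] E →L[ℝ] ℝ) : E →L[ℝ] E →L[ℝ] E →L[ℝ] ℝ :=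
  (1 / 2 : ℝ) • (D + D.flip -
    (ContinuousLinearMap.flipₗᵢ ℝ E E ℝ).toContinuousLinearEquiv.toContinuousLinearMap ∘L D.flip)

theorem koszul_apply (D : E →L[ℝ] E →L[ℝ] E →L[ℝ] ℝ) (u v w : E) :
    koszul D u v w = (1 / 2) * (D u v w + D v u w - D w u v) := by
  simp [koszul]

/-- The pullback of a trilinear form by a linear map. -/
def trilinearComp (D : F →L[ℝ] F →L[ℝ] F →L[ℝ] ℝ) (P : E →L[ℝ] F) :
    E →L[ℝ] E →L[ℝ] E →L[ℝ] ℝ :=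
  ((ContinuousLinearMap.compL ℝ E (F →L[ℝ] ℝ) (E →L[ℝ] ℝ)
    ((ContinuousLinearMap.compL ℝ E F ℝ).flip P))) ∘L (D.bilinearComp P P)

theorem trilinearComp_apply (D : F →L[ℝ] F →L[ℝ] F →L[ℝ] ℝ) (P : E →L[ℝ] F) (u v w : E) :
    trilinearComp D P u v w = D (P u) (P v) (P w) := by
  simp [trilinearComp]

/-- Transformation law of the Christoffel symbols under an isometric immersion: differentiating
`G = f^* G'` gives the second derivative of `f` in terms of its first derivative. -/
theorem second_derivative_of_isometry {s : Set E} (hs : UniqueDiffOn ℝ s)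
    (hs' : s ⊆ closure (interior s)) {t : Set F} {G : E → E →L[ℝ] E →L[ℝ] ℝ}
    {G' : F → F →L[ℝ] F →L[ℝ] ℝ} {f : E → F} {y : E} (hy : y ∈ s)
    (hf : ContDiffWithinAt ℝ 2 f s y) (hft : ∀ᶠ z in 𝓝[s] y, f z ∈ t)
    (hG : DifferentiableWithinAt ℝ G s y) (hG' : DifferentiableWithinAt ℝ G' t (f y))
    (hsymm : ∀ a b, G' (f y) a b = G' (f y) b a)
    (hiso : ∀ᶠ z in 𝓝[s] y, ∀ u v,
      G z u v = G' (f z) (fderivWithin ℝ f s z u) (fderivWithin ℝ f s z v)) (u v w : E) :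
    G' (f y) (fderivWithin ℝ (fderivWithin ℝ f s) s y u v) (fderivWithin ℝ f s y w)
      = (koszul (fderivWithin ℝ G s y)
          - trilinearComp (koszul (fderivWithin ℝ G' t (f y))) (fderivWithin ℝ f s y)) u v w := by
  set P := fderivWithin ℝ f s with hP
  set Q := fderivWithin ℝ P s y with hQ
  have hfd : HasFDerivWithinAt f (P y) s y :=
    (hf.differentiableWithinAt (by norm_num)).hasFDerivWithinAt
  have hPd : HasFDerivWithinAt P Q s y :=
    ((hf.fderivWithin_right hs (m := 1) (by norm_num) hy).differentiableWithinAt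
      (by norm_num)).hasFDerivWithinAt
  -- Symmetry of a second derivative taken within `s` holds at a boundary point because `s` lies in
  -- the closure of its interior.
  have hQsymm : ∀ a b, Q a b = Q b a :=
    hf.isSymmSndFDerivWithinAt (by simp) hs (hs' hy) hy
  have hG'f : HasFDerivWithinAt (fun z => G' (f z)) (fderivWithin ℝ G' t (f y) ∘L P y) s y := by
    have h := hG'.hasFDerivWithinAt
    refine HasFDerivWithinAt.comp_of_tendsto y h hfd ?_
    exact tendsto_nhdsWithin_iff.2 ⟨hfd.continuousWithinAt, hft⟩
  -- The product rule applied to `G(b,c) = G'(f)(Df b, Df c)` in the direction `a`.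
  have key : ∀ a b c, fderivWithin ℝ G s y a b c
      = fderivWithin ℝ G' t (f y) (P y a) (P y b) (P y c)
        + G' (f y) (Q a b) (P y c) + G' (f y) (P y b) (Q a c) := by
    intro a b c
    have h1 := ((hG.hasFDerivWithinAt.clm_apply (hasFDerivWithinAt_const b y s)).clm_apply
      (hasFDerivWithinAt_const c y s))
    have h2 := ((hG'f.clm_apply (hPd.clm_apply (hasFDerivWithinAt_const b y s))).clm_apply
      (hPd.clm_apply (hasFDerivWithinAt_const c y s)))
    have h3 := h2.congr_of_eventuallyEq (f₁ := fun z => G z b c)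
      (by filter_upwards [hiso] with z hz using hz b c) (hiso.self_of_nhdsWithin hy b c)
    have h4 := congrArg (fun L : E →L[ℝ] ℝ => L a) ((hs y hy).eq h1 h3)
    simp at h4
    linarith
  -- Of the six terms containing `Q`, four cancel by symmetry of `Q` and of `G'`; the remaining two
  -- are equal and absorb the factor `1/2`.
  simp only [sub_apply, trilinearComp_apply, koszul_apply, key]
  rw [hQsymm v u, hQsymm w u, hQsymm w v, hsymm (Q u w) (P y v), hsymm (P y u) (Q v w)]
  ring_nf

end Rigidity

/-! ### Local rigidity in a vector space. -/

section Rigidity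

variable {E : Type*} [NormedAddCommGroup E] [NormedSpace ℝ E] [FiniteDimensional ℝ E]
  {F : Type*} [NormedAddCommGroup F] [NormedSpace ℝ F] [FiniteDimensional ℝ F]

theorem contDiffWithinAt_koszul {D : Type*} [NormedAddCommGroup D] [NormedSpace ℝ D]
    {n : ℕ∞ω} {T : D → E →L[ℝ] E →L[ℝ] E →L[ℝ] ℝ} {s : Set D} {x : D}
    (h : ContDiffWithinAt ℝ n T s x) : ContDiffWithinAt ℝ n (fun p => koszul (T p)) s x := by
  have h3 : ∀ a b c, ContDiffWithinAt ℝ n (fun p => T p a b c) s x := fun a b c =>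
    ((h.clm_apply contDiffWithinAt_const).clm_apply contDiffWithinAt_const).clm_apply
      contDiffWithinAt_const
  refine contDiffWithinAt_clm_of_apply fun u => contDiffWithinAt_clm_of_apply fun v =>
    contDiffWithinAt_clm_of_apply fun w => ?_
  simp only [koszul_apply]
  exact contDiffWithinAt_const.mul (((h3 u v w).add (h3 v u w)).sub (h3 w u v))

omit [FiniteDimensional ℝ F] in
theorem contDiffWithinAt_trilinearComp {D : Type*} [NormedAddCommGroup D] [NormedSpace ℝ D]
    {n : ℕ∞ω} {T : D → F →L[ℝ] F →L[ℝ] F →L[ℝ] ℝ} {P : D → E →L[ℝ] F} {s : Set D} {x : D}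
    (h : ContDiffWithinAt ℝ n T s x) (hP : ContDiffWithinAt ℝ n P s x) :
    ContDiffWithinAt ℝ n (fun p => trilinearComp (T p) (P p)) s x := by
  have hP' : ∀ a, ContDiffWithinAt ℝ n (fun p => P p a) s x := fun a =>
    hP.clm_apply contDiffWithinAt_const
  refine contDiffWithinAt_clm_of_apply fun u => contDiffWithinAt_clm_of_apply fun v =>
    contDiffWithinAt_clm_of_apply fun w => ?_
  simp only [trilinearComp_apply]
  exact ((h.clm_apply (hP' u)).clm_apply (hP' v)).clm_apply (hP' w)

/-- The map `a ↦ b(a, P ·)` of a bilinear form `b`. -/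
def lowerComp (b : F →L[ℝ] F →L[ℝ] ℝ) (P : E →L[ℝ] F) : F →L[ℝ] E →L[ℝ] ℝ :=
  ((ContinuousLinearMap.compL ℝ E F ℝ).flip P) ∘L b

omit [FiniteDimensional ℝ E] [FiniteDimensional ℝ F] in
theorem lowerComp_apply (b : F →L[ℝ] F →L[ℝ] ℝ) (P : E →L[ℝ] F) (a : F) (w : E) :
    lowerComp b P a w = b a (P w) := by
  simp [lowerComp]

omit [FiniteDimensional ℝ E] [FiniteDimensional ℝ F] in
theorem continuous_lowerComp :
    Continuous fun p : (F →L[ℝ] F →L[ℝ] ℝ) × (E →L[ℝ] F) => lowerComp p.1 p.2 := by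
  unfold lowerComp
  exact ((ContinuousLinearMap.compL ℝ E F ℝ).flip.continuous.comp continuous_snd).clm_comp
    continuous_fst

omit [FiniteDimensional ℝ E] [FiniteDimensional ℝ F] in
theorem tendsto_lowerComp {α : Type*} {l : Filter α} {b : α → F →L[ℝ] F →L[ℝ] ℝ}
    {b₀ : F →L[ℝ] F →L[ℝ] ℝ} {P : α → E →L[ℝ] F} {P₀ : E →L[ℝ] F} (hb : Tendsto b l (𝓝 b₀))
    (hP : Tendsto P l (𝓝 P₀)) :
    Tendsto (fun a => lowerComp (b a) (P a)) l (𝓝 (lowerComp b₀ P₀)) := by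
  have h : Tendsto (fun p : (F →L[ℝ] F →L[ℝ] ℝ) × (E →L[ℝ] F) => lowerComp p.1 p.2)
      (𝓝 (b₀, P₀)) (𝓝 (lowerComp b₀ P₀)) := continuous_lowerComp.tendsto (b₀, P₀)
  have h' : Tendsto (fun x => (b x, P x)) l (𝓝 (b₀, P₀)) := hb.prodMk_nhds hP
  have h'' := h.comp h'
  exact h''

omit [FiniteDimensional ℝ F] in
theorem eventually_isInvertible {L : E →L[ℝ] F} (hL : L.IsInvertible) :
    ∀ᶠ L' in 𝓝 L, L'.IsInvertible := by
  have := FiniteDimensional.complete ℝ E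
  obtain ⟨e, rfl⟩ := hL
  exact e.nhds

/-- Equal dimensions make `P` surjective, so a vector in the kernel is `b`-orthogonal to everything
and vanishes; a dimension count with the dual of `E` finishes. This permits solving the
transformation law for the second derivative, which occurs there only paired with vectors `P w`. -/
theorem isInvertible_lowerComp (hEF : Module.finrank ℝ E = Module.finrank ℝ F)
    {b : F →L[ℝ] F →L[ℝ] ℝ} {P : E →L[ℝ] F} (hb : ∀ a, (∀ c, b a c = 0) → a = 0)
    (hP : Function.Injective P) : (lowerComp b P).IsInvertible := by
  have hPs : Function.Surjective P :=
    (LinearMap.injective_iff_surjective_of_finrank_eq_finrank (f := P.toLinearMap) hEF).1 hP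
  have hinj : Function.Injective (lowerComp b P).toLinearMap := by
    rw [← LinearMap.ker_eq_bot, LinearMap.ker_eq_bot']
    intro a ha
    refine hb a fun c => ?_
    obtain ⟨w, rfl⟩ := hPs c
    rw [← lowerComp_apply]
    exact congrArg (fun L : E →L[ℝ] ℝ => L w) ha
  have hdim : Module.finrank ℝ F = Module.finrank ℝ (E →L[ℝ] ℝ) := by
    rw [← (LinearMap.toContinuousLinearMap (𝕜 := ℝ) (E := E) (F' := ℝ)).finrank_eq,
      ← hEF]
    exact (Subspace.dual_finrank_eq (K := ℝ) (V := E)).symm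
  refine ⟨(LinearEquiv.ofInjectiveOfFinrankEq _ hinj hdim).toContinuousLinearEquiv, ?_⟩
  rfl

/-- The right-hand side of the total differential system for `(f, Df)` of an isometric immersion
`f`. -/
def isometrySystem (s : Set E) (t : Set F) (G : E → E →L[ℝ] E →L[ℝ] ℝ)
    (G' : F → F →L[ℝ] F →L[ℝ] ℝ) (p : E × (F × (E →L[ℝ] F))) :
    E →L[ℝ] (F × (E →L[ℝ] F)) :=
  p.2.2.prod ((ContinuousLinearMap.compL ℝ E (E →L[ℝ] ℝ) F
    (lowerComp (G' p.2.1) p.2.2).inverse) ∘L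
      (koszul (fderivWithin ℝ G s p.1) - trilinearComp (koszul (fderivWithin ℝ G' t p.2.1)) p.2.2))

/-- The Koszul terms cost one derivative of the metrics, so `C^2` metrics leave a `C^1` right-hand
side, and operator inversion is smooth at an invertible operator. This is the regularity required by
the uniqueness theorem. -/
theorem contDiffWithinAt_isometrySystem {s : Set E} {t : Set F} (hs : UniqueDiffOn ℝ s)
    (ht : UniqueDiffOn ℝ t) {G : E → E →L[ℝ] E →L[ℝ] ℝ} {G' : F → F →L[ℝ] F →L[ℝ] ℝ}
    {y : E} {z : F} {P : E →L[ℝ] F} (hy : y ∈ s) (hz : z ∈ t)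
    (hG : ContDiffWithinAt ℝ 2 G s y) (hG' : ContDiffWithinAt ℝ 2 G' t z)
    (hinv : (lowerComp (G' z) P).IsInvertible) :
    ContDiffWithinAt ℝ 1 (isometrySystem s t G G') (s ×ˢ (t ×ˢ univ)) (y, (z, P)) := by
  set S : Set (E × (F × (E →L[ℝ] F))) := s ×ˢ (t ×ˢ univ)
  set x : E × (F × (E →L[ℝ] F)) := (y, (z, P))
  have h1 : MapsTo (fun p : E × (F × (E →L[ℝ] F)) => p.1) S s := fun p hp => hp.1
  have h2 : MapsTo (fun p : E × (F × (E →L[ℝ] F)) => p.2.1) S t := fun p hp => hp.2.1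
  have c1 : ContDiffWithinAt ℝ 1 (fun p : E × (F × (E →L[ℝ] F)) => p.1) S x :=
    contDiff_fst.contDiffWithinAt
  have c2 : ContDiffWithinAt ℝ 1 (fun p : E × (F × (E →L[ℝ] F)) => p.2.1) S x :=
    (contDiff_fst.comp contDiff_snd).contDiffWithinAt
  have c3 : ContDiffWithinAt ℝ 1 (fun p : E × (F × (E →L[ℝ] F)) => p.2.2) S x :=
    (contDiff_snd.comp contDiff_snd).contDiffWithinAt
  have dG : ContDiffWithinAt ℝ 1 (fun p : E × (F × (E →L[ℝ] F)) => fderivWithin ℝ G s p.1) S x :=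
    (hG.fderivWithin_right hs (m := 1) (by norm_num) hy).comp x c1 h1
  have dG' : ContDiffWithinAt ℝ 1
      (fun p : E × (F × (E →L[ℝ] F)) => fderivWithin ℝ G' t p.2.1) S x :=
    (hG'.fderivWithin_right ht (m := 1) (by norm_num) hz).comp x c2 h2
  have cG' : ContDiffWithinAt ℝ 1 (fun p : E × (F × (E →L[ℝ] F)) => G' p.2.1) S x :=
    (hG'.of_le (by norm_num)).comp x c2 h2
  have cR := (contDiffWithinAt_koszul dG).sub
    (contDiffWithinAt_trilinearComp (contDiffWithinAt_koszul dG') c3)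
  have cB : ContDiffWithinAt ℝ 1
      (fun p : E × (F × (E →L[ℝ] F)) => lowerComp (G' p.2.1) p.2.2) S x := by
    refine contDiffWithinAt_clm_of_apply fun a => contDiffWithinAt_clm_of_apply fun w => ?_
    simp only [lowerComp_apply]
    exact (cG'.clm_apply contDiffWithinAt_const).clm_apply (c3.clm_apply contDiffWithinAt_const)
  have cI : ContDiffWithinAt ℝ 1
      (fun p : E × (F × (E →L[ℝ] F)) => (lowerComp (G' p.2.1) p.2.2).inverse) S x :=
    ContDiffAt.comp_contDiffWithinAt x
      (g := ContinuousLinearMap.inverse)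
      (ContinuousLinearMap.IsInvertible.contDiffAt_map_inverse (by exact hinv)) cB
  refine contDiffWithinAt_clm_of_apply fun u => ?_
  refine (c3.clm_apply contDiffWithinAt_const).prodMk ?_
  refine contDiffWithinAt_clm_of_apply fun v => ?_
  exact cI.clm_apply ((cR.clm_apply contDiffWithinAt_const).clm_apply contDiffWithinAt_const)

-- The first component of the system is tautological; the second is the transformation law with the
-- lowered index raised again by the inverse of `lowerComp`.
omit [FiniteDimensional ℝ E] [FiniteDimensional ℝ F] in
theorem hasFDerivWithinAt_isometrySystem {s : Set E} (hs : UniqueDiffOn ℝ s)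
    (hs' : s ⊆ closure (interior s)) {t : Set F} {G : E → E →L[ℝ] E →L[ℝ] ℝ}
    {G' : F → F →L[ℝ] F →L[ℝ] ℝ} {f : E → F} {y : E} (hy : y ∈ s)
    (hf : ContDiffWithinAt ℝ 2 f s y) (hft : ∀ᶠ z in 𝓝[s] y, f z ∈ t)
    (hG : DifferentiableWithinAt ℝ G s y) (hG' : DifferentiableWithinAt ℝ G' t (f y))
    (hsymm : ∀ a b, G' (f y) a b = G' (f y) b a)
    (hiso : ∀ᶠ z in 𝓝[s] y, ∀ u v,
      G z u v = G' (f z) (fderivWithin ℝ f s z u) (fderivWithin ℝ f s z v))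
    (hinv : (lowerComp (G' (f y)) (fderivWithin ℝ f s y)).IsInvertible) :
    HasFDerivWithinAt (fun z => (f z, fderivWithin ℝ f s z))
      (isometrySystem s t G G' (y, (f y, fderivWithin ℝ f s y))) s y := by
  have hfd : HasFDerivWithinAt f (fderivWithin ℝ f s y) s y :=
    (hf.differentiableWithinAt (by norm_num)).hasFDerivWithinAt
  have hPd : HasFDerivWithinAt (fderivWithin ℝ f s)
      (fderivWithin ℝ (fderivWithin ℝ f s) s y) s y :=
    ((hf.fderivWithin_right hs (m := 1) (by norm_num) hy).differentiableWithinAt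
      (by norm_num)).hasFDerivWithinAt
  refine (hfd.prodMk hPd).congr_fderiv ?_
  unfold isometrySystem
  congr 1
  ext u v
  refine (hinv.inverse_apply_eq.2 ?_).symm
  ext w
  rw [lowerComp_apply]
  exact (second_derivative_of_isometry hs hs' hy hf hft hG hG' hsymm hiso u v w).symm

/-- Two isometric immersions between domains of the same dimension coincide near a point if they
have the same first-order jet there. -/
theorem eventuallyEq_of_isometry (hEF : Module.finrank ℝ E = Module.finrank ℝ F)
    {s : Set E} (hsc : Convex ℝ s) (hs : UniqueDiffOn ℝ s) (hs' : s ⊆ closure (interior s))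
    {t : Set F} (htc : Convex ℝ t) (ht : UniqueDiffOn ℝ t)
    {G : E → E →L[ℝ] E →L[ℝ] ℝ} {G' : F → F →L[ℝ] F →L[ℝ] ℝ} {f₁ f₂ : E → F} {y : E}
    (hy : y ∈ s) (hG : ContDiffWithinAt ℝ 2 G s y) (hG' : ContDiffWithinAt ℝ 2 G' t (f₁ y))
    (hsymm : ∀ᶠ z in 𝓝[t] f₁ y, ∀ a b, G' z a b = G' z b a)
    (hnd : ∀ a, (∀ c, G y a c = 0) → a = 0) (hnd' : ∀ a, (∀ c, G' (f₁ y) a c = 0) → a = 0)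
    (hf₁ : ContDiffWithinAt ℝ 2 f₁ s y) (hf₂ : ContDiffWithinAt ℝ 2 f₂ s y)
    (ht₁ : ∀ᶠ z in 𝓝[s] y, f₁ z ∈ t) (ht₂ : ∀ᶠ z in 𝓝[s] y, f₂ z ∈ t)
    (hiso₁ : ∀ᶠ z in 𝓝[s] y, ∀ u v,
      G z u v = G' (f₁ z) (fderivWithin ℝ f₁ s z u) (fderivWithin ℝ f₁ s z v))
    (hiso₂ : ∀ᶠ z in 𝓝[s] y, ∀ u v,
      G z u v = G' (f₂ z) (fderivWithin ℝ f₂ s z u) (fderivWithin ℝ f₂ s z v))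
    (h₀ : f₁ y = f₂ y) (h₁ : fderivWithin ℝ f₁ s y = fderivWithin ℝ f₂ s y) :
    f₁ =ᶠ[𝓝[s] y] f₂ := by
  -- A vector killed by `Df₁` is `G`-orthogonal to everything, so nondegeneracy of `G` makes an
  -- isometric map an immersion.
  have hinj : Function.Injective (fderivWithin ℝ f₁ s y) := by
    rw [injective_iff_map_eq_zero]
    intro a ha
    refine hnd a fun c => ?_
    rw [hiso₁.self_of_nhdsWithin hy, ha, map_zero, zero_apply]
  have hinv := isInvertible_lowerComp hEF hnd' hinj
  have hA := contDiffWithinAt_isometrySystem hs ht hy (ht₁.self_of_nhdsWithin hy) hG hG' hinv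
  have key : ∀ f : E → F, ContDiffWithinAt ℝ 2 f s y → (∀ᶠ z in 𝓝[s] y, f z ∈ t) →
      (∀ᶠ z in 𝓝[s] y, ∀ u v,
        G z u v = G' (f z) (fderivWithin ℝ f s z u) (fderivWithin ℝ f s z v)) →
      f y = f₁ y → fderivWithin ℝ f s y = fderivWithin ℝ f₁ s y →
      ∀ᶠ z in 𝓝[s] y, (f z, fderivWithin ℝ f s z) ∈ t ×ˢ (univ : Set (E →L[ℝ] F)) ∧
        HasFDerivWithinAt (fun z => (f z, fderivWithin ℝ f s z))
          (isometrySystem s t G G' (z, (f z, fderivWithin ℝ f s z))) s z := by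
    intro f hf hft hiso h0 h1
    have hlim : Tendsto f (𝓝[s] y) (𝓝[t] (f₁ y)) := by
      rw [← h0]
      exact tendsto_nhdsWithin_iff.2 ⟨hf.continuousWithinAt, hft⟩
    have hPc : ContinuousWithinAt (fderivWithin ℝ f s) s y :=
      (hf.fderivWithin_right hs (m := 1) (by norm_num) hy).continuousWithinAt
    have hins : insert y s = s := insert_eq_of_mem hy
    have e1 : ∀ᶠ z in 𝓝[s] y, ContDiffWithinAt ℝ 2 f s z := by
      simpa [hins] using hf.eventually (by norm_num)
    have e2 : ∀ᶠ z in 𝓝[s] y, ContDiffWithinAt ℝ 2 G s z := by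
      simpa [hins] using hG.eventually (by norm_num)
    have e3 : ∀ᶠ z in 𝓝[t] (f₁ y), ContDiffWithinAt ℝ 2 G' t z := by
      simpa [insert_eq_of_mem (ht₁.self_of_nhdsWithin hy)] using hG'.eventually (by norm_num)
    -- Invertibility is an open condition, so it passes from `y` to nearby points; the differential
    -- equation is needed there, not only at `y`.
    have e4 : ∀ᶠ z in 𝓝[s] y, (lowerComp (G' (f z)) (fderivWithin ℝ f s z)).IsInvertible := by
      have hc : Tendsto (fun z => lowerComp (G' (f z)) (fderivWithin ℝ f s z)) (𝓝[s] y)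
          (𝓝 (lowerComp (G' (f₁ y)) (fderivWithin ℝ f₁ s y))) := by
        have hGc : Tendsto (fun z => G' (f z)) (𝓝[s] y) (𝓝 (G' (f₁ y))) :=
          hG'.continuousWithinAt.tendsto.comp hlim
        have hPc' : Tendsto (fderivWithin ℝ f s) (𝓝[s] y) (𝓝 (fderivWithin ℝ f₁ s y)) := by
          rw [← h1]; exact hPc
        exact tendsto_lowerComp hGc hPc'
      exact hc.eventually (eventually_isInvertible hinv)
    filter_upwards [self_mem_nhdsWithin, eventually_eventually_nhdsWithin.2 hft,
      eventually_eventually_nhdsWithin.2 hiso, hlim.eventually hsymm, e1, e2,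
      hlim.eventually e3, e4] with z hz a1 a2 a3 a4 a5 a6 a7
    exact ⟨⟨a1.self_of_nhdsWithin hz, mem_univ _⟩,
      hasFDerivWithinAt_isometrySystem hs hs' hz a4 a1 (a5.differentiableWithinAt (by norm_num))
        (a6.differentiableWithinAt (by norm_num)) a3 a2 a7⟩
  have := eventuallyEq_of_total_differential hsc (htc.prod convex_univ) hy hA
    (key f₁ hf₁ ht₁ hiso₁ rfl rfl) (key f₂ hf₂ ht₂ hiso₂ h₀.symm h₁.symm) rfl
    (by rw [h₀, h₁])
  filter_upwards [this] with z hz using congrArg Prod.fst hz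

end Rigidity

/-! ### Transfer to manifolds through charts, and the open-closed argument. -/

section ManifoldRigidity

variable {E : Type*} [NormedAddCommGroup E] [NormedSpace ℝ E]
  {H : Type*} [TopologicalSpace H] {I : ModelWithCorners ℝ E H}
  {M : Type*} [TopologicalSpace M] [ChartedSpace H M]
  {F : Type*} [NormedAddCommGroup F] [NormedSpace ℝ F]
  {K : Type*} [TopologicalSpace K] {J : ModelWithCorners ℝ F K}
  {N : Type*} [TopologicalSpace N] [ChartedSpace K N]

/-- Nondegeneracy of a field of bilinear forms. -/
def IsNondegenerateForm (g : FormField I M) : Prop :=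
  ∀ (p : M) (u : TangentSpace I p), (∀ v, g p u v = 0) → u = 0

/-- A nonzero vector orthogonal to everything would be orthogonal to the timelike vector of the
signature condition, hence spacelike, yet also orthogonal to itself. -/
theorem IsLorentz.isNondegenerateForm {g : FormField I M} (hg : IsLorentz g) :
    IsNondegenerateForm g := by
  intro p u hu
  obtain ⟨v, -, hv⟩ := hg.signature p
  by_contra hne
  have := hv u (by rw [hg.symm]; exact hu v) hne
  exact this.ne' (hu u)

/-- The coordinate expression of a field of bilinear forms, as a function with values in the
continuous bilinear forms. -/
def chartMetric (g : FormField I M) (x : M) (y : E) : E →L[ℝ] E →L[ℝ] ℝ :=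
  let b : E →L[ℝ] E →L[ℝ] ℝ := g ((extChartAt I x).symm y)
  let d : E →L[ℝ] E := mfderivWithin 𝓘(ℝ, E) I (extChartAt I x).symm (range I) y
  b.bilinearComp d d

theorem chartMetric_apply (g : FormField I M) (x : M) (y u v : E) :
    chartMetric g x y u v = chartForm g x y u v := rfl

theorem IsSmoothForm.contDiffWithinAt_chartMetric [FiniteDimensional ℝ E] {g : FormField I M}
    (hg : IsSmoothForm g) {x : M} {y : E} (hy : y ∈ (extChartAt I x).target) :
    ContDiffWithinAt ℝ 2 (chartMetric g x) (range I) y := by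
  refine ContDiffWithinAt.mono_of_mem_nhdsWithin (s := (extChartAt I x).target) ?_
    (extChartAt_target_mem_nhdsWithin_of_mem hy)
  refine contDiffWithinAt_clm_of_apply fun u => contDiffWithinAt_clm_of_apply fun v => ?_
  exact (hg x u v y hy).of_le (WithTop.coe_le_coe.2 (le_top : (2 : ℕ∞) ≤ ⊤))

theorem IsSymmForm.chartMetric_symm {g : FormField I M} (hg : IsSymmForm g) (x : M) (y u v : E) :
    chartMetric g x y u v = chartMetric g x y v u := by
  have h := hg ((extChartAt I x).symm y)
    (mfderivWithin 𝓘(ℝ, E) I (extChartAt I x).symm (range I) y u)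
    (mfderivWithin 𝓘(ℝ, E) I (extChartAt I x).symm (range I) y v)
  rw [chartMetric_apply, chartMetric_apply]
  exact h

theorem IsNondegenerateForm.chartMetric_eq_zero [IsManifold I 1 M] {g : FormField I M}
    (hg : IsNondegenerateForm g) {x : M} {y : E} (hy : y ∈ (extChartAt I x).target) (u : E)
    (hu : ∀ v, chartMetric g x y u v = 0) : u = 0 := by
  obtain ⟨e, he⟩ := isInvertible_mfderivWithin_extChartAt_symm (I := I) hy
  have h : e u = 0 := by
    refine hg _ _ fun w => ?_
    have h' : g ((extChartAt I x).symm y)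
        (mfderivWithin 𝓘(ℝ, E) I (extChartAt I x).symm (range I) y u)
        (mfderivWithin 𝓘(ℝ, E) I (extChartAt I x).symm (range I) y (e.symm w)) = 0 :=
      hu (e.symm w)
    rw [← he] at h'
    have h'' : g ((extChartAt I x).symm y) (e u) (e (e.symm w)) = 0 := h'
    rwa [e.apply_symm_apply] at h''
  exact e.map_eq_zero_iff.1 h

theorem contDiffWithinAt_chart_expression {Ψ : M → N} (hΨ : ContMDiff I J ∞ Ψ) [IsManifold I ∞ M]
    [IsManifold J ∞ N] {x : M} {z : N} (hx : Ψ x ∈ (extChartAt J z).source) :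
    ContDiffWithinAt ℝ 2 (extChartAt J z ∘ Ψ ∘ (extChartAt I x).symm) (range I)
      (extChartAt I x x) := by
  have h := (contMDiffAt_iff_of_mem_source (mem_chart_source H x)
    (by simpa using hx)).1 (hΨ.contMDiffAt (x := x))
  exact h.2.of_le (WithTop.coe_le_coe.2 (le_top : (2 : ℕ∞) ≤ ⊤))

/-- By the chain rule the differential of the chart of `N` cancels against that of its inverse
inside `chartMetric g'`, leaving `g'` evaluated on the image of `dΨ`. -/
theorem isometry_chart_expression [IsManifold I 1 M] [IsManifold J 1 N] {g : FormField I M}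
    {g' : FormField J N} {Ψ : M → N} (hΨ : MDifferentiable I J Ψ) (hiso : pullbackForm Ψ g' = g)
    {x : M} {z : N} {y : E} (hy : y ∈ (extChartAt I x).target)
    (hyz : Ψ ((extChartAt I x).symm y) ∈ (extChartAt J z).source) (u v : E) :
    chartMetric g x y u v =
      chartMetric g' z ((extChartAt J z ∘ Ψ ∘ (extChartAt I x).symm) y)
        (fderivWithin ℝ (extChartAt J z ∘ Ψ ∘ (extChartAt I x).symm) (range I) y u)
        (fderivWithin ℝ (extChartAt J z ∘ Ψ ∘ (extChartAt I x).symm) (range I) y v) := by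
  set f := extChartAt J z ∘ Ψ ∘ (extChartAt I x).symm with hf
  set q := (extChartAt I x).symm y with hq
  have hu : UniqueMDiffWithinAt 𝓘(ℝ, E) (range I) y :=
    (I.uniqueDiffOn y (extChartAt_target_subset_range x hy)).uniqueMDiffWithinAt
  have hd1 := mdifferentiableWithinAt_extChartAt_symm (I := I) hy
  have hd2 := mdifferentiableAt_extChartAt (I := J) (x := z) (y := Ψ q) (by simpa using hyz)
  have hD : fderivWithin ℝ f (range I) y
      = (mfderiv J 𝓘(ℝ, F) (extChartAt J z) (Ψ q)) ∘L ((mfderiv I J Ψ q) ∘L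
        (mfderivWithin 𝓘(ℝ, E) I (extChartAt I x).symm (range I) y)) := by
    rw [← mfderivWithin_eq_fderivWithin, hf]
    rw [mfderiv_comp_mfderivWithin y (I' := J) hd2 ((hΨ q).comp_mdifferentiableWithinAt y hd1) hu]
    rw [mfderiv_comp_mfderivWithin y (I' := I) (hΨ q) hd1 hu]
    rfl
  have hinv := mfderivWithin_extChartAt_symm_comp_mfderiv_extChartAt' (I := J) hyz
  have hfy : f y = extChartAt J z (Ψ q) := rfl
  have hcomp : ∀ w : E, mfderivWithin 𝓘(ℝ, F) J (extChartAt J z).symm (range J) (f y)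
      (fderivWithin ℝ f (range I) y w) = mfderiv I J Ψ q
        (mfderivWithin 𝓘(ℝ, E) I (extChartAt I x).symm (range I) y w) := by
    intro w
    rw [hD, hfy]
    exact congrArg (fun L : F →L[ℝ] F => L (mfderiv I J Ψ q
        (mfderivWithin 𝓘(ℝ, E) I (extChartAt I x).symm (range I) y w))) hinv
  -- The point obtained by applying the chart of `N` and then its inverse is only propositionally
  -- equal to `Ψ q`; reading the forms on the common model space `F` avoids transport between
  -- tangent spaces.
  have hbase : ∀ (q' : N) (_ : q' = Ψ q) (a b : F),
      (show F →L[ℝ] F →L[ℝ] ℝ from g' q') a b = (show F →L[ℝ] F →L[ℝ] ℝ from g' (Ψ q)) a b := by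
    rintro q' rfl a b; rfl
  calc chartMetric g x y u v = (show F →L[ℝ] F →L[ℝ] ℝ from g' (Ψ q))
        (mfderiv I J Ψ q (mfderivWithin 𝓘(ℝ, E) I (extChartAt I x).symm (range I) y u))
        (mfderiv I J Ψ q (mfderivWithin 𝓘(ℝ, E) I (extChartAt I x).symm (range I) y v)) := by
        rw [← hiso]; rfl
    _ = _ := by
        rw [chartMetric_apply, chartForm]
        erw [hcomp u, hcomp v]
        exact (hbase _ ((extChartAt J z).left_inv hyz) _ _).symm

/-- Isometric immersions between manifolds of the same dimension are locally determined by their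
first-order jet, expressed in charts. -/
theorem eventuallyEq_of_isometric_of_jet [FiniteDimensional ℝ E] [FiniteDimensional ℝ F]
    [IsManifold I ∞ M] [IsManifold J ∞ N]
    (hEF : Module.finrank ℝ E = Module.finrank ℝ F) {g : FormField I M} {g' : FormField J N}
    (hg : IsSmoothForm g) (hg' : IsSmoothForm g') (hsymm : IsSymmForm g')
    (hnd : IsNondegenerateForm g) (hnd' : IsNondegenerateForm g') {Ψ₁ Ψ₂ : M → N}
    (h₁ : ContMDiff I J ∞ Ψ₁) (h₂ : ContMDiff I J ∞ Ψ₂)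
    (hiso₁ : pullbackForm Ψ₁ g' = g) (hiso₂ : pullbackForm Ψ₂ g' = g) {x : M}
    (hx : Ψ₁ x = Ψ₂ x)
    (hd : fderivWithin ℝ (extChartAt J (Ψ₁ x) ∘ Ψ₁ ∘ (extChartAt I x).symm) (range I)
        (extChartAt I x x) =
      fderivWithin ℝ (extChartAt J (Ψ₁ x) ∘ Ψ₂ ∘ (extChartAt I x).symm) (range I)
        (extChartAt I x x)) :
    Ψ₁ =ᶠ[𝓝 x] Ψ₂ := by
  have : IsManifold I 1 M := IsManifold.of_le (n := ∞) (by exact_mod_cast le_top)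
  have : IsManifold J 1 N := IsManifold.of_le (n := ∞) (by exact_mod_cast le_top)
  -- The same chart of `N`, centred at the common value, serves both maps.
  set z := Ψ₁ x with hz
  have hs₁ : Ψ₁ x ∈ (extChartAt J z).source := mem_extChartAt_source z
  have hs₂ : Ψ₂ x ∈ (extChartAt J z).source := hx ▸ mem_extChartAt_source z
  have hsymmx : (extChartAt I x).symm (extChartAt I x x) = x := extChartAt_to_inv x
  have hrange : ∀ (Ψ : M → N) (y : E), (extChartAt J z ∘ Ψ ∘ (extChartAt I x).symm) y ∈ range J :=
    fun Ψ y => mem_range_self _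
  have hsrc : ∀ Ψ : M → N, ContMDiff I J ∞ Ψ → Ψ x ∈ (extChartAt J z).source →
      ∀ᶠ y in 𝓝[range I] (extChartAt I x x), y ∈ (extChartAt I x).target ∧
        Ψ ((extChartAt I x).symm y) ∈ (extChartAt J z).source := by
    intro Ψ hΨ hΨx
    have hc : Tendsto (extChartAt I x).symm (𝓝[range I] (extChartAt I x x)) (𝓝 x) := by
      have := (continuousAt_extChartAt_symm (I := I) x).tendsto
      rw [hsymmx] at this
      exact this.mono_left nhdsWithin_le_nhds
    exact Filter.Eventually.and (extChartAt_target_mem_nhdsWithin x)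
      (hc.eventually (hΨ.continuous.continuousAt.eventually
        ((isOpen_extChartAt_source z).mem_nhds hΨx)))
  have hcenter : ∀ Ψ : M → N, (extChartAt J z ∘ Ψ ∘ (extChartAt I x).symm) (extChartAt I x x)
      = extChartAt J z (Ψ x) := fun Ψ => by simp
  have key := eventuallyEq_of_isometry hEF I.convex_range I.uniqueDiffOn
    I.range_subset_closure_interior J.convex_range J.uniqueDiffOn
    (G := chartMetric g x) (G' := chartMetric g' z)
    (f₁ := extChartAt J z ∘ Ψ₁ ∘ (extChartAt I x).symm)
    (f₂ := extChartAt J z ∘ Ψ₂ ∘ (extChartAt I x).symm) (y := extChartAt I x x)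
    (mem_range_self _) (hg.contDiffWithinAt_chartMetric (mem_extChartAt_target x))
    (by
      rw [hcenter]
      exact hg'.contDiffWithinAt_chartMetric (mem_extChartAt_target z))
    (Eventually.of_forall fun y => hsymm.chartMetric_symm z y)
    (hnd.chartMetric_eq_zero (mem_extChartAt_target x))
    (by
      rw [hcenter]
      exact hnd'.chartMetric_eq_zero (mem_extChartAt_target z))
    (contDiffWithinAt_chart_expression h₁ hs₁) (contDiffWithinAt_chart_expression h₂ hs₂)
    (Eventually.of_forall (hrange Ψ₁)) (Eventually.of_forall (hrange Ψ₂))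
    ((hsrc Ψ₁ h₁ hs₁).mono fun y hy u v => isometry_chart_expression
      (h₁.mdifferentiable (by simp)) hiso₁ hy.1 hy.2 u v)
    ((hsrc Ψ₂ h₂ hs₂).mono fun y hy u v => isometry_chart_expression
      (h₂.mdifferentiable (by simp)) hiso₂ hy.1 hy.2 u v)
    (by rw [hcenter, hcenter, ← hx]) hd
  have key' : ∀ᶠ q in 𝓝 x, (extChartAt J z ∘ Ψ₁ ∘ (extChartAt I x).symm) (extChartAt I x q) =
      (extChartAt J z ∘ Ψ₂ ∘ (extChartAt I x).symm) (extChartAt I x q) := by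
    have hm := map_extChartAt_nhds (I := I) x
    rw [← hm] at key
    exact key
  filter_upwards [key', extChartAt_source_mem_nhds (I := I) x,
    h₁.continuous.continuousAt.eventually ((isOpen_extChartAt_source z).mem_nhds hs₁),
    h₂.continuous.continuousAt.eventually ((isOpen_extChartAt_source z).mem_nhds hs₂)]
    with q a1 a2 a3 a4
  simp only [Function.comp_apply, (extChartAt I x).left_inv a2] at a1
  exact (extChartAt J z).injOn a3 a4 a1

/-- Rigidity: isometric immersions of a connected manifold into a manifold of the same dimension
coincide if they coincide to first order at one point. -/
theorem eq_of_isometric_of_jet [FiniteDimensional ℝ E] [FiniteDimensional ℝ F]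
    [IsManifold I ∞ M] [IsManifold J ∞ N] [PreconnectedSpace M] [T2Space N]
    (hEF : Module.finrank ℝ E = Module.finrank ℝ F) {g : FormField I M} {g' : FormField J N}
    (hg : IsSmoothForm g) (hg' : IsSmoothForm g') (hsymm : IsSymmForm g')
    (hnd : IsNondegenerateForm g) (hnd' : IsNondegenerateForm g') {Ψ₁ Ψ₂ : M → N}
    (h₁ : ContMDiff I J ∞ Ψ₁) (h₂ : ContMDiff I J ∞ Ψ₂)
    (hiso₁ : pullbackForm Ψ₁ g' = g) (hiso₂ : pullbackForm Ψ₂ g' = g) {x : M}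
    (hx : Ψ₁ x = Ψ₂ x)
    (hd : fderivWithin ℝ (extChartAt J (Ψ₁ x) ∘ Ψ₁ ∘ (extChartAt I x).symm) (range I)
        (extChartAt I x x) =
      fderivWithin ℝ (extChartAt J (Ψ₁ x) ∘ Ψ₂ ∘ (extChartAt I x).symm) (range I)
        (extChartAt I x x)) :
    Ψ₁ = Ψ₂ := by
  -- With equality of germs as the condition, openness is immediate and all the work lies in
  -- closedness.
  set A : Set M := {q | Ψ₁ =ᶠ[𝓝 q] Ψ₂} with hA
  have hopen : IsOpen A := by
    rw [isOpen_iff_mem_nhds]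
    exact fun q hq => eventually_eventuallyEq_nhds.2 hq
  have hclosed : IsClosed A := by
    refine isClosed_of_closure_subset fun p hp => ?_
    have hpz : Ψ₁ p = Ψ₂ p := by
      have hsub : closure A ⊆ {q | Ψ₁ q = Ψ₂ q} :=
        closure_minimal (fun q hq => EventuallyEq.eq_of_nhds hq)
          (isClosed_eq h₁.continuous h₂.continuous)
      exact hsub hp
    -- At a limit point the values agree since `N` is Hausdorff; local rigidity reduces the claim to
    -- equality of first derivatives.
    refine eventuallyEq_of_isometric_of_jet hEF hg hg' hsymm hnd hnd' h₁ h₂ hiso₁ hiso₂ hpz ?_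
    set z := Ψ₁ p with hz
    set f₁ := extChartAt J z ∘ Ψ₁ ∘ (extChartAt I p).symm
    set f₂ := extChartAt J z ∘ Ψ₂ ∘ (extChartAt I p).symm
    have hP : ∀ Ψ : M → N, ContMDiff I J ∞ Ψ → Ψ p ∈ (extChartAt J z).source →
        Tendsto (fderivWithin ℝ (extChartAt J z ∘ Ψ ∘ (extChartAt I p).symm) (range I))
          (𝓝[range I] (extChartAt I p p))
          (𝓝 (fderivWithin ℝ (extChartAt J z ∘ Ψ ∘ (extChartAt I p).symm) (range I)
            (extChartAt I p p))) := by
      intro Ψ hΨ hΨp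
      exact ((contDiffWithinAt_chart_expression hΨ hΨp).fderivWithin_right I.uniqueDiffOn
        (m := 1) (by norm_num) (mem_range_self _)).continuousWithinAt
    have hlim := (hP Ψ₁ h₁ (mem_extChartAt_source z)).prodMk_nhds
      (hP Ψ₂ h₂ (hpz ▸ mem_extChartAt_source z))
    -- Points of `A` accumulate at `p`, and equal germs there give equal chart derivatives. These
    -- derivatives are continuous and the diagonal is closed, so equality survives at `p`.
    have hfreq : ∃ᶠ y in 𝓝[range I] (extChartAt I p p),
        (fderivWithin ℝ f₁ (range I) y, fderivWithin ℝ f₂ (range I) y) ∈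
          diagonal (E →L[ℝ] F) := by
      rw [← map_extChartAt_nhds (I := I) p, frequently_map]
      refine ((mem_closure_iff_frequently.1 hp).and_eventually
        (extChartAt_source_mem_nhds (I := I) p)).mono ?_
      rintro q ⟨hq, hqs⟩
      have hc : Tendsto (extChartAt I p).symm (𝓝[range I] (extChartAt I p q)) (𝓝 q) := by
        have := (continuousAt_extChartAt_symm' (I := I) hqs).tendsto
        rw [(extChartAt I p).left_inv hqs] at this
        exact this.mono_left nhdsWithin_le_nhds
      have hfe : f₁ =ᶠ[𝓝[range I] (extChartAt I p q)] f₂ := by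
        filter_upwards [hc.eventually hq] with y hy
        simp only [f₁, f₂, Function.comp_apply, hy]
      exact hfe.fderivWithin_eq (hfe.eq_of_nhdsWithin (mem_range_self _))
    exact isClosed_diagonal.mem_of_frequently_of_tendsto hfreq hlim
  have hxA : x ∈ A :=
    eventuallyEq_of_isometric_of_jet hEF hg hg' hsymm hnd hnd' h₁ h₂ hiso₁ hiso₂ hx hd
  have huniv : A = univ := IsClopen.eq_univ ⟨hclosed, hopen⟩ ⟨x, hxA⟩
  funext q
  have : q ∈ A := huniv ▸ mem_univ q
  exact EventuallyEq.eq_of_nhds this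

end ManifoldRigidity

/-! ### Two pointwise facts: hyperplanes, and differentials at the boundary. -/

/-- Linear maps agreeing on two distinct hyperplanes are equal. -/
theorem linearMap_ext_of_two_hyperplanes {V A C W : Type*} [AddCommGroup V] [Module ℝ V]
    [FiniteDimensional ℝ V] [AddCommGroup A] [Module ℝ A] [AddCommGroup C] [Module ℝ C]
    [AddCommGroup W] [Module ℝ W] {a : A →ₗ[ℝ] V} {c : C →ₗ[ℝ] V} {π : V →ₗ[ℝ] ℝ}
    (hπ : π ≠ 0) (ha : Function.Injective a) (hc : Function.Injective c)
    (hA : Module.finrank ℝ V = Module.finrank ℝ A + 1)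
    (hC : Module.finrank ℝ V = Module.finrank ℝ C + 1)
    (haπ : ∀ u, π (a u) = 0) {v : V} (hv : π v = 0) (hvc : ∀ w, c w ≠ v) {L₁ L₂ : V →ₗ[ℝ] W}
    (h₁ : ∀ u, L₁ (a u) = L₂ (a u)) (h₂ : ∀ u, L₁ (c u) = L₂ (c u)) : L₁ = L₂ := by
  by_contra hne
  -- If the maps differed, `Q` would be a proper subspace containing two subspaces of codimension
  -- one, so both would equal `Q`. But the range of `a` is the kernel of `π` and contains `v`, which
  -- the range of `c` omits.
  set Q := LinearMap.eqLocus L₁ L₂ with hQ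
  have hQt : Q ≠ ⊤ := fun h => hne (LinearMap.eqLocus_eq_top.1 h)
  have hlt : Module.finrank ℝ Q < Module.finrank ℝ V := Submodule.finrank_lt hQt
  have ra := LinearMap.finrank_range_of_inj ha
  have rc := LinearMap.finrank_range_of_inj hc
  have hker : Module.finrank ℝ (LinearMap.ker π) < Module.finrank ℝ V :=
    Submodule.finrank_lt fun h => hπ (LinearMap.ker_eq_top.1 h)
  have ea : LinearMap.range a = LinearMap.ker π := by
    refine Submodule.eq_of_le_of_finrank_le ?_ (by omega)
    rintro _ ⟨u, rfl⟩
    exact haπ u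
  have ea' : LinearMap.range a = Q := by
    refine Submodule.eq_of_le_of_finrank_le ?_ (by omega)
    rintro _ ⟨u, rfl⟩
    exact h₁ u
  have ec : LinearMap.range c = Q := by
    refine Submodule.eq_of_le_of_finrank_le ?_ (by omega)
    rintro _ ⟨u, rfl⟩
    exact h₂ u
  have hvr : v ∈ LinearMap.range c := by rw [ec, ← ea', ea]; exact hv
  obtain ⟨w, hw⟩ := hvr
  exact hvc w hw

/-- The differential of a map into a manifold with boundary takes values in the tangent space of the
boundary at the points that are mapped to the boundary. -/
theorem normalCoord_mfderiv_eq_zero {n : ℕ} [NeZero n] {M : Type*} [TopologicalSpace M]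
    [ChartedSpace (EuclideanHalfSpace n) M] {F : Type*} [NormedAddCommGroup F] [NormedSpace ℝ F]
    {K : Type*} [TopologicalSpace K] {J : ModelWithCorners ℝ F K} [J.Boundaryless] {N : Type*}
    [TopologicalSpace N] [ChartedSpace K N] {f : N → M} {q : N}
    (hq : f q ∈ (𝓡∂ n).boundary M) (hf : MDifferentiableAt J (𝓡∂ n) f q)
    (v : TangentSpace J q) : normalCoord (mfderiv J (𝓡∂ n) f q v) = 0 := by
  set W := writtenInExtChartAt J (𝓡∂ n) q f with hW
  have hrange : ∀ y, 0 ≤ W y 0 := by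
    intro y
    have : W y ∈ range (𝓡∂ n) := mem_range_self _
    rwa [range_modelWithCornersEuclideanHalfSpace] at this
  have hcenter : W (extChartAt J q q) 0 = 0 := by
    have h : extChartAt (𝓡∂ n) (f q) (f q) ∈ frontier (range (𝓡∂ n)) := hq
    rw [frontier_range_modelWithCornersEuclideanHalfSpace] at h
    have h' : W (extChartAt J q q) = extChartAt (𝓡∂ n) (f q) (f q) := by simp [hW]
    rw [h']
    exact h.symm
  let f' : F →L[ℝ] EuclideanSpace ℝ (Fin n) := mfderiv J (𝓡∂ n) f q
  have hd : HasFDerivAt W f' (extChartAt J q q) := by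
    have h : HasFDerivWithinAt W f' (range J) (extChartAt J q q) := hf.hasMFDerivAt.2
    rwa [J.range_eq_univ, hasFDerivWithinAt_univ] at h
  -- The first coordinate of a half-space is nonnegative and vanishes at the image of `q`. As `N`
  -- has no boundary, this is an unconstrained minimum and the derivative vanishes.
  have hmin : IsLocalMin (fun y => W y 0) (extChartAt J q q) :=
    Eventually.of_forall fun y => hcenter.trans_le (hrange y)
  have hder : HasFDerivAt (fun y => W y 0)
      ((EuclideanSpace.proj (0 : Fin n) : EuclideanSpace ℝ (Fin n) →L[ℝ] ℝ) ∘L f')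
      (extChartAt J q q) :=
    (EuclideanSpace.proj (0 : Fin n) :
      EuclideanSpace ℝ (Fin n) →L[ℝ] ℝ).hasFDerivAt.comp _ hd
  exact congrArg (fun L : F →L[ℝ] ℝ => L v) (hmin.hasFDerivAt_eq_zero hder)

/-! ### Comparing differentials, intrinsically and in charts. -/

section Jets

variable {E : Type*} [NormedAddCommGroup E] [NormedSpace ℝ E]
  {H : Type*} [TopologicalSpace H] {I : ModelWithCorners ℝ E H}
  {M : Type*} [TopologicalSpace M] [ChartedSpace H M]
  {F : Type*} [NormedAddCommGroup F] [NormedSpace ℝ F]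
  {K : Type*} [TopologicalSpace K] {J : ModelWithCorners ℝ F K}
  {N : Type*} [TopologicalSpace N] [ChartedSpace K N]
  {X : Type*} [NormedAddCommGroup X] [NormedSpace ℝ X]
  {L : Type*} [TopologicalSpace L] {I' : ModelWithCorners ℝ X L}
  {Q : Type*} [TopologicalSpace Q] [ChartedSpace L Q]

/-- Maps that agree along `Z` have the same differential on the image of the differential
of `Z`. -/
theorem mfderiv_comp_eq_of_eventuallyEq {Ψ₁ Ψ₂ : M → N} {Z : Q → M} {q : Q}
    (h₁ : MDifferentiableAt I J Ψ₁ (Z q)) (h₂ : MDifferentiableAt I J Ψ₂ (Z q))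
    (hZ : MDifferentiableAt I' I Z q) (h : Ψ₁ ∘ Z =ᶠ[𝓝 q] Ψ₂ ∘ Z) :
    (show E →L[ℝ] F from mfderiv I J Ψ₁ (Z q)) ∘L (show X →L[ℝ] E from mfderiv I' I Z q) =
      (show E →L[ℝ] F from mfderiv I J Ψ₂ (Z q)) ∘L (show X →L[ℝ] E from mfderiv I' I Z q) := by
  have e₁ := mfderiv_comp q h₁ hZ
  have e₂ := mfderiv_comp q h₂ hZ
  have e := h.mfderiv_eq (I := I') (I' := J)
  exact e₁.symm.trans (e.trans e₂)

/-- Maps with the same value and the same differential at a point have the same derivative in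
charts. -/
theorem fderivWithin_chart_eq_of_mfderiv_eq {Ψ₁ Ψ₂ : M → N} {x : M}
    (h₁ : MDifferentiableAt I J Ψ₁ x) (h₂ : MDifferentiableAt I J Ψ₂ x) (hx : Ψ₁ x = Ψ₂ x)
    (h : (show E →L[ℝ] F from mfderiv I J Ψ₁ x) = (show E →L[ℝ] F from mfderiv I J Ψ₂ x)) :
    fderivWithin ℝ (extChartAt J (Ψ₁ x) ∘ Ψ₁ ∘ (extChartAt I x).symm) (range I)
        (extChartAt I x x) =
      fderivWithin ℝ (extChartAt J (Ψ₁ x) ∘ Ψ₂ ∘ (extChartAt I x).symm) (range I)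
        (extChartAt I x x) := by
  have hu : UniqueDiffWithinAt ℝ (range I) (extChartAt I x x) :=
    I.uniqueDiffOn _ (mem_range_self _)
  let L₁ : E →L[ℝ] F := mfderiv I J Ψ₁ x
  let L₂ : E →L[ℝ] F := mfderiv I J Ψ₂ x
  have d₁ : HasFDerivWithinAt (writtenInExtChartAt I J x Ψ₁) L₁ (range I) (extChartAt I x x) :=
    h₁.hasMFDerivAt.2
  have d₂ : HasFDerivWithinAt (writtenInExtChartAt I J x Ψ₂) L₂ (range I) (extChartAt I x x) :=
    h₂.hasMFDerivAt.2
  have e₁ := d₁.fderivWithin hu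
  have e₂ := d₂.fderivWithin hu
  simp only [writtenInExtChartAt, ← hx] at e₁ e₂
  exact e₁.trans (h.trans e₂.symm)

end Jets

/-! ### The 1-jet at the corner, and uniqueness. -/

section Corner

variable {S : Type*} [TopologicalSpace S] [ChartedSpace (EuclideanHalfSpace 3) S]
  {Sig : Type*} [TopologicalSpace Sig] [ChartedSpace (EuclideanSpace ℝ (Fin 2)) Sig]
  [IsManifold (𝓡 2) ∞ Sig]

theorem Background.continuous_incl (B : Background S Sig) : Continuous B.incl :=
  continuous_fst.prodMk (B.bd_embedding.isEmbedding.continuous.comp continuous_snd)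

variable {B : Background S Sig} {d : InitialBoundaryData B}
  {M : Type*} [TopologicalSpace M] [ChartedSpace (EuclideanHalfSpace 4) M]
  [IsManifold (𝓡∂ 4) ∞ M]
  {M' : Type*} [TopologicalSpace M'] [ChartedSpace (EuclideanHalfSpace 4) M']
  [IsManifold (𝓡∂ 4) ∞ M']

namespace VacuumDevelopment

theorem preconnectedSpace (D : VacuumDevelopment d M) [ConnectedSpace S] : PreconnectedSpace M := by
  obtain ⟨e⟩ := D.product
  have : PreconnectedSpace symInterval := Subtype.preconnectedSpace isPreconnected_Ioo
  exact e.toHomeomorph.symm.surjective.denseRange.preconnectedSpace e.toHomeomorph.symm.continuous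

theorem t2Space (D : VacuumDevelopment d M) [T2Space S] : T2Space M := by
  obtain ⟨e⟩ := D.product
  exact e.toHomeomorph.symm.t2Space

/-- `Υ'` is relatively open in `Υ`, which contains all of `C₀`. Hence `ι ∘ incl` is controlled on a
full neighbourhood in `C₀`, and its unrestricted differential is meaningful even at the corner. -/
theorem preimage_incl_dom_mem_nhds (D : VacuumDevelopment d M)
    {q : ℝ × Sig} (hq : B.incl q ∈ D.dom) :
    B.incl ⁻¹' D.dom ∈ 𝓝 q := by
  obtain ⟨V, hV, hdom⟩ := D.dom_open
  have : B.incl ⁻¹' D.dom = B.incl ⁻¹' V := by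
    rw [hdom, preimage_inter]
    exact inter_eq_left.2 fun q _ => Or.inr (mem_range_self q)
  rw [this]
  refine (hV.preimage B.continuous_incl).mem_nhds ?_
  rw [hdom] at hq
  exact hq.1

theorem incl_mem_boundary (D : VacuumDevelopment d M) {q : ℝ × Sig} (hq : B.incl q ∈ D.dom) :
    D.ι (B.incl q) ∈ (𝓡∂ 4).boundary M := by
  rw [← D.ι_image_boundary]
  exact mem_image_of_mem _ ⟨hq, mem_range_self q⟩

/-- Tangent vectors to the initial surface are spacelike. -/
theorem pos_mfderiv_slice (D : VacuumDevelopment d M) (x : S) (w : TangentSpace (𝓡∂ 3) x)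
    (hw : w ≠ 0) :
    0 < D.g (D.ι (0, x)) (mfderiv (𝓡∂ 3) (𝓡∂ 4) (fun x : S => D.ι (0, x)) x w)
      (mfderiv (𝓡∂ 3) (𝓡∂ 4) (fun x : S => D.ι (0, x)) x w) := by
  have h := d.γ_riemannian.pos x w hw
  rw [← D.induced_metric] at h
  exact h

theorem mfderiv_slice_injective (D : VacuumDevelopment d M) (x : S) :
    Function.Injective (mfderiv (𝓡∂ 3) (𝓡∂ 4) (fun x : S => D.ι (0, x)) x) := by
  rw [injective_iff_map_eq_zero]
  intro w hw
  by_contra hne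
  have h := D.pos_mfderiv_slice x w hne
  rw [hw, map_zero] at h
  exact lt_irrefl _ h

/-- Every nonzero vector tangent to the initial surface is spacelike. This separates the tangent
hyperplane of that surface from the one of the timelike boundary. -/
theorem mfderiv_slice_ne_of_timelike (D : VacuumDevelopment d M) (x : S)
    {v : TangentSpace (𝓡∂ 4) (D.ι (0, x))} (hv : D.g (D.ι (0, x)) v v < 0)
    (w : TangentSpace (𝓡∂ 3) x) :
    mfderiv (𝓡∂ 3) (𝓡∂ 4) (fun x : S => D.ι (0, x)) x w ≠ v := by
  rintro rfl
  by_cases hw : w = 0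
  · rw [hw, map_zero, map_zero] at hv
    exact lt_irrefl _ hv
  · exact lt_asymm (D.pos_mfderiv_slice x w hw) hv

theorem mdifferentiableAt_boundary (D : VacuumDevelopment d M) {q : ℝ × Sig}
    (hq : B.incl q ∈ D.dom) : MDifferentiableAt bdryModel (𝓡∂ 4) (D.ι ∘ B.incl) q :=
  (D.ι_boundary_smooth.contMDiffAt (D.preimage_incl_dom_mem_nhds hq)).mdifferentiableAt (by simp)

variable {D : VacuumDevelopment d M} {D' : VacuumDevelopment d M'}

/-- At the corner, the differential of an extension embedding is determined by the conditions on
the initial surface and on the boundary. -/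
theorem IsExtensionEmbedding.mfderiv_eq_at_corner {Ψ₁ Ψ₂ : M → M'}
    (h₁ : D.IsExtensionEmbedding D' Ψ₁) (h₂ : D.IsExtensionEmbedding D' Ψ₂) (y : Sig) :
    (show EuclideanSpace ℝ (Fin 4) →L[ℝ] EuclideanSpace ℝ (Fin 4) from
      mfderiv (𝓡∂ 4) (𝓡∂ 4) Ψ₁ (D.ι (0, B.bd y))) =
    (show EuclideanSpace ℝ (Fin 4) →L[ℝ] EuclideanSpace ℝ (Fin 4) from
      mfderiv (𝓡∂ 4) (𝓡∂ 4) Ψ₂ (D.ι (0, B.bd y))) := by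
  have hqd : B.incl (0, y) ∈ D.dom := D.slice_subset_dom (B.bd y)
  have hpb := D.incl_mem_boundary hqd
  have dZ := D.mdifferentiableAt_boundary hqd
  have di : MDifferentiableAt (𝓡∂ 3) (𝓡∂ 4) (fun x : S => D.ι (0, x)) (B.bd y) :=
    D.ι_slice.contMDiff.contMDiffAt.mdifferentiableAt (by simp)
  have dΨ₁ : MDifferentiableAt (𝓡∂ 4) (𝓡∂ 4) Ψ₁ (D.ι (0, B.bd y)) :=
    h₁.smooth.mdifferentiable (by simp) _
  have dΨ₂ : MDifferentiableAt (𝓡∂ 4) (𝓡∂ 4) Ψ₂ (D.ι (0, B.bd y)) :=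
    h₂.smooth.mdifferentiable (by simp) _
  -- Near the corner `ι` sends `C₀` into the boundary of `M`, where both embeddings equal `φ'⁻¹ ∘
  -- φ`.
  have eZ : Ψ₁ ∘ (D.ι ∘ B.incl) =ᶠ[𝓝 (0, y)] Ψ₂ ∘ (D.ι ∘ B.incl) := by
    filter_upwards [D.preimage_incl_dom_mem_nhds hqd] with r hr
    have hr' := D.incl_mem_boundary hr
    exact (h₁.on_boundary _ hr').2.trans (h₂.on_boundary _ hr').2.symm
  have ei : Ψ₁ ∘ (fun x : S => D.ι (0, x)) =ᶠ[𝓝 (B.bd y)] Ψ₂ ∘ (fun x : S => D.ι (0, x)) :=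
    Eventually.of_forall fun x => (h₁.on_slice x).trans (h₂.on_slice x).symm
  have ka := mfderiv_comp_eq_of_eventuallyEq (Z := D.ι ∘ B.incl) dΨ₁ dΨ₂ dZ eZ
  have kc := mfderiv_comp_eq_of_eventuallyEq (Z := fun x : S => D.ι (0, x)) dΨ₁ dΨ₂ di ei
  -- The witness that the hyperplanes differ: `v` is tangent to the boundary and timelike, so it
  -- cannot be tangent to the initial surface.
  obtain ⟨v, hv, hvt⟩ := D.timelike_boundary _ hpb
  have hπ : (EuclideanSpace.proj (0 : Fin 4) :
      EuclideanSpace ℝ (Fin 4) →L[ℝ] ℝ).toLinearMap ≠ 0 := by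
    intro h
    have := congrArg (fun L : EuclideanSpace ℝ (Fin 4) →ₗ[ℝ] ℝ =>
      L (EuclideanSpace.single 0 1)) h
    simp at this
  refine ContinuousLinearMap.coe_injective (linearMap_ext_of_two_hyperplanes hπ
    (a := (show (ℝ × EuclideanSpace ℝ (Fin 2)) →L[ℝ] EuclideanSpace ℝ (Fin 4) from
      mfderiv bdryModel (𝓡∂ 4) (D.ι ∘ B.incl) (0, y)).toLinearMap)
    (c := (show EuclideanSpace ℝ (Fin 3) →L[ℝ] EuclideanSpace ℝ (Fin 4) from
      mfderiv (𝓡∂ 3) (𝓡∂ 4) (fun x : S => D.ι (0, x)) (B.bd y)).toLinearMap)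
    (v := (show EuclideanSpace ℝ (Fin 4) from v))
    (D.ι_boundary_immersion (0, y) hqd) (D.mfderiv_slice_injective (B.bd y)) (by simp) (by simp)
    (normalCoord_mfderiv_eq_zero (f := D.ι ∘ B.incl) hpb dZ) hv
    (D.mfderiv_slice_ne_of_timelike (B.bd y) hvt) (DFunLike.congr_fun ka) (DFunLike.congr_fun kc))

/-- Extension embeddings are unique. -/
theorem IsExtensionEmbedding.unique [T2Space S] [ConnectedSpace S] [Nonempty Sig]
    {Ψ₁ Ψ₂ : M → M'} (h₁ : D.IsExtensionEmbedding D' Ψ₁) (h₂ : D.IsExtensionEmbedding D' Ψ₂) :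
    Ψ₁ = Ψ₂ := by
  have := D.preconnectedSpace
  have := D'.t2Space
  -- Nonemptiness of `Σ` supplies the corner point from which rigidity propagates over the connected
  -- manifold `M`.
  obtain ⟨y⟩ := ‹Nonempty Sig›
  have hx : Ψ₁ (D.ι (0, B.bd y)) = Ψ₂ (D.ι (0, B.bd y)) :=
    (h₁.on_slice _).trans (h₂.on_slice _).symm
  refine eq_of_isometric_of_jet rfl D.lorentz.smooth D'.lorentz.smooth D'.lorentz.symm
    D.lorentz.isNondegenerateForm D'.lorentz.isNondegenerateForm h₁.smooth h₂.smooth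
    h₁.isometric h₂.isometric hx ?_
  exact fderivWithin_chart_eq_of_mfderiv_eq (h₁.smooth.mdifferentiable (by simp) _)
    (h₂.smooth.mdifferentiable (by simp) _) hx (h₁.mfderiv_eq_at_corner h₂ y)

end VacuumDevelopment

end Corner

end IBVP

end

/-- The isometric embedding of a vacuum development into an extension of it is unique. -/
theorem lemma5p10
    {S : Type*} [TopologicalSpace S] [T2Space S] [CompactSpace S] [ConnectedSpace S]
    [ChartedSpace (EuclideanHalfSpace 3) S] [IsManifold (𝓡∂ 3) ∞ S]
    {Sig : Type*} [TopologicalSpace Sig] [Nonempty Sig]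
    [ChartedSpace (EuclideanSpace ℝ (Fin 2)) Sig] [IsManifold (𝓡 2) ∞ Sig]
    (B : IBVP.Background S Sig) (d : IBVP.InitialBoundaryData B)
    {M : Type*} [TopologicalSpace M] [ChartedSpace (EuclideanHalfSpace 4) M]
    [IsManifold (𝓡∂ 4) ∞ M]
    {M' : Type*} [TopologicalSpace M'] [ChartedSpace (EuclideanHalfSpace 4) M']
    [IsManifold (𝓡∂ 4) ∞ M']
    (D : IBVP.VacuumDevelopment d M) (D' : IBVP.VacuumDevelopment d M')
    (hext : D.IsExtension D') :
    ∃! Ψ : M → M', D.IsExtensionEmbedding D' Ψ := by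
  obtain ⟨Ψ, hΨ⟩ := hext
  exact ⟨Ψ, hΨ, fun Ψ' hΨ' => hΨ'.unique hΨ⟩
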